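/- Let $m\ge 0$ and let $C=\bigoplus_{k\in\mathbb Z}C_k$ be a chain complex of abelian groups whose underlying group is $\mathbb{Z}^m$ (column vectors), such that every standard unit vector $\sigma_1,\dots,\sigma_m$ is homogeneous and $\mathcal K_p=\mathrm{span}_{\mathbb Z}\{\sigma_1,\dots,\sigma_p\}$ is a subcomplex for every $0\le p\le m$ (a \emph{standard-form chain complex}, with canonical filtration $\mathcal K=\{\mathcal K_p\}_{p=0}^m$). Let $D\in\mathbb Z^{m\times m}$ be the matrix of its differential, regarded as a rational matrix. For a matrix $R\in\mathbb{Q}^{m\times m}$ put $\mathrm{low}_R(j)=\max\{i:R_{ij}\ne0\}$ if $\mathrm{Col}_j(R)\neq 0$ and $\mathrm{low}_R(j)=0$ otherwise; the \emph{trailing coefficient} of a nonzero column $j$ is $R_{\mathrm{low}_R(j),j}$. The \emph{standard algorithm} starts with $R=D$ and $V=I$ and, for $j=1,\dots,m$ in this order, does the following: while some $j'<j$ satisfies $\mathrm{low}_R(j')=\mathrm{low}_R(j)=i>0$, it subtracts $\frac{R_{ij}}{R_{ij'}}$ times column $j'$ from column $j$, in $R$ and in $V$. Let $R=DV$ be its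 output over $\mathbb Q$. Let $J\in\mathbb Q^{m\times m}$ be the matrix whose column $j$ is $\mathrm{Col}_r(R)/R_{\mathrm{low}_R(r),r}$ if $\mathrm{low}_R(r)=j$ for some (necessarily unique) $r$, and $\mathrm{Col}_j(V)$ otherwise; let $M=J^{-1}DJ$. Let $H_k(\mathcal K;\mathbb Z)$ be the persistence module $H_k(\mathcal K_0;\mathbb Z)\to\cdots\to H_k(\mathcal K_m;\mathbb Z)$ induced by the inclusions. An \emph{interval module} (of free abelian groups) is a persistence module on $\{0,\dots,m\}$ isomorphic to the one that, for some $0\le b<d\le m+1$, is $\mathbb Z$ at the indices $b\le p<d$ with identity maps between them, and $0$ elsewhere. For a $k$-cycle $z$ of $C$, let $p=\min\{i:z\in\mathcal K_i\}$, and let $\mathcal P(z)\subseteq H_k(\mathcal K;\mathbb Z)$ be the \emph{principal submodule} generated by $z$, that is, the smallest persistence submodule that contains the class $[z]\in H_k(\mathcal K_p;\mathbb Z)$. \textbf{Theorem.} The following are equivalent. \begin{enumerate} \item The trailing coefficient of every nonzero column of $R$ is $1$ or $-1$. \item For every $k\in\mathbb Z$, $H_k(\mathcal K;\mathbb Z)$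 is isomorphic to a (finite) direct sum of interval modules. \item The matrix $J$ has integer entries and, for every $k\in\mathbb Z$, each element of $$E_k=\{\mathrm{Col}_j(J):1\le j\le m,\ \sigma_j\in C_k,\ \mathrm{Col}_j(M)=0\}$$ is a $k$-cycle, each $\mathcal P(z)$ with $z\in E_k$ is an interval module, and $$H_k(\mathcal K;\mathbb Z)=\bigoplus_{z\in E_k}\mathcal P(z)$$ as an internal direct sum of persistence submodules. \end{enumerate} -/

import Mathlib

open CategoryTheory

/-! ### Reduction of matrices: the standard algorithm -/

namespace StdReduction

variable {m : ℕ}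

/-- `low R j` is the largest row number `i` (rows numbered `1, …, m`) with nonzero entry in
column `j` of `R`, and `0` if the column is zero. The row with number `i` has index `i - 1` in
`Fin m`. -/
def low (R : Matrix (Fin m) (Fin m) ℚ) (j : Fin m) : ℕ :=
  (Finset.univ.filter fun i => R i j ≠ 0).sup fun i => i.val + 1

theorem low_le (R : Matrix (Fin m) (Fin m) ℚ) (j : Fin m) : low R j ≤ m :=
  Finset.sup_le fun i _ => i.isLt

theorem lt_low {R : Matrix (Fin m) (Fin m) ℚ} {i j : Fin m} (h : R i j ≠ 0) :
    i.val < low R j :=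
  Finset.le_sup (f := fun i : Fin m => i.val + 1) (by simpa using h)

theorem eq_zero_of_low_le {R : Matrix (Fin m) (Fin m) ℚ} {i j : Fin m}
    (h : low R j ≤ i.val) : R i j = 0 := by
  by_contra h0
  exact absurd (lt_low h0) (not_lt.mpr h)

/-- The index in `Fin m` of the last nonzero entry of a nonzero column. -/
def lowIndex (R : Matrix (Fin m) (Fin m) ℚ) (j : Fin m) (h : 0 < low R j) : Fin m :=
  ⟨low R j - 1, lt_of_lt_of_le (Nat.sub_one_lt_of_lt h) (low_le R j)⟩

theorem lowIndex_ne_zero (R : Matrix (Fin m) (Fin m) ℚ) (j : Fin m) (h : 0 < low R j) :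
    R (lowIndex R j h) j ≠ 0 := by
  have hne : (Finset.univ.filter fun i => R i j ≠ 0).Nonempty := by
    by_contra hc
    rw [Finset.not_nonempty_iff_eq_empty] at hc
    simp [low, hc] at h
  obtain ⟨i, hi, hs⟩ := Finset.exists_mem_eq_sup _ hne (fun i : Fin m => i.val + 1)
  have : lowIndex R j h = i := by
    apply Fin.ext
    change low R j - 1 = i.val
    unfold low
    omega
  rw [this]
  exact (Finset.mem_filter.mp hi).2

/-- The trailing coefficient of column `j` of `R`; by convention `0` if the column is zero. -/
def trailing (R : Matrix (Fin m) (Fin m) ℚ) (j : Fin m) : ℚ :=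
  if h : 0 < low R j then R (lowIndex R j h) j else 0

/-- The column operation `Col_j(A) ← Col_j(A) - c • Col_{j'}(A)`. -/
def colSub (A : Matrix (Fin m) (Fin m) ℚ) (j : Fin m) (c : ℚ) (j' : Fin m) :
    Matrix (Fin m) (Fin m) ℚ :=
  A.updateCol j fun i => A i j - c * A i j'

/-- The guard of the inner loop: some earlier column has the same (positive) `low` as column `j`. -/
def Guard (R : Matrix (Fin m) (Fin m) ℚ) (j j' : Fin m) : Prop :=
  j' < j ∧ 0 < low R j ∧ low R j' = low R j

instance (R : Matrix (Fin m) (Fin m) ℚ) (j : Fin m) : DecidablePred (Guard R j) :=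
  fun _ => inferInstanceAs (Decidable (_ ∧ _ ∧ _))

theorem low_colSub_lt {R : Matrix (Fin m) (Fin m) ℚ} {j j' : Fin m} (h : Guard R j j') :
    low (colSub R j (trailing R j / trailing R j') j') j < low R j := by
  obtain ⟨-, hpos, heq⟩ := h
  have hpos' : 0 < low R j' := heq ▸ hpos
  have hidx : lowIndex R j' hpos' = lowIndex R j hpos := Fin.ext (by simp [lowIndex, heq])
  refine (Finset.sup_lt_iff (by simpa using hpos)).2 fun i hi => ?_
  simp only [colSub, Matrix.updateCol_self, Finset.mem_filter, Finset.mem_univ, true_and] at hi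
  by_contra hlt
  rcases Nat.lt_or_ge i.val (low R j) with h1 | h1
  · have hi' : i = lowIndex R j hpos := Fin.ext (by simp only [lowIndex]; omega)
    have hne := lowIndex_ne_zero R j' hpos'
    apply hi
    simp only [trailing, hpos, hpos', dif_pos, hidx] at hne ⊢
    rw [hi', div_mul_cancel₀ _ hne, sub_self]
  · apply hi
    have e1 : R i j = 0 := eq_zero_of_low_le h1
    have e2 : R i j' = 0 := eq_zero_of_low_le (heq.le.trans h1)
    simp [e1, e2]

/-- The inner `while` loop of the standard algorithm, acting on the pair `(R, V)`: as long as some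
`j' < j` has `low R j' = low R j > 0`, the multiple of column `j'` that cancels the trailing
coefficient of column `j` of `R` is subtracted from column `j`, in `R` and in `V`. -/
def reduceColumn (j : Fin m) (s : Matrix (Fin m) (Fin m) ℚ × Matrix (Fin m) (Fin m) ℚ) :
    Matrix (Fin m) (Fin m) ℚ × Matrix (Fin m) (Fin m) ℚ :=
  if h : ∃ j', Guard s.1 j j' then
    reduceColumn j
      (colSub s.1 j (trailing s.1 j / trailing s.1 (Fin.find (Guard s.1 j) h))
          (Fin.find (Guard s.1 j) h),
        colSub s.2 j (trailing s.1 j / trailing s.1 (Fin.find (Guard s.1 j) h))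
          (Fin.find (Guard s.1 j) h))
  else s
termination_by low s.1 j
decreasing_by exact low_colSub_lt (Fin.find_spec h)

/-- The standard algorithm: start from `(D, I)` and reduce the columns from left to right. -/
def standardAlgorithm (D : Matrix (Fin m) (Fin m) ℚ) :
    Matrix (Fin m) (Fin m) ℚ × Matrix (Fin m) (Fin m) ℚ :=
  (List.finRange m).foldl (fun s j => reduceColumn j s) (D, 1)

open Classical in
/-- The matrix `J` built from `R` and `V`: its column number `j` is `Col_r(R)` divided by its
trailing coefficient if `low R r = j` for some `r`, and `Col_j(V)` otherwise. -/
noncomputable def matchingBasis (R V : Matrix (Fin m) (Fin m) ℚ) : Matrix (Fin m) (Fin m) ℚ :=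
  fun i j =>
    if h : ∃ r, low R r = j.val + 1 then R i h.choose / trailing R h.choose else V i j

end StdReduction

/-! ### Persistence modules -/

/-- Persistence modules over `A` indexed by `{0, …, m}`. -/
abbrev PersistenceModule (A : Type) [CommRing A] (m : ℕ) := Fin (m + 1) ⥤ ModuleCat.{0} A

namespace PersistenceModule

variable {A : Type} [CommRing A] {m : ℕ}

/-- The structure map `f_p → f_q` for `p ≤ q`. -/
def str (F : PersistenceModule A m) {p q : Fin (m + 1)} (h : p ≤ q) : F.obj p →ₗ[A] F.obj q :=
  (F.map (homOfLE h)).hom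

/-- A persistence module from linear maps that satisfy the functor laws. -/
def mk' (X : Fin (m + 1) → Type) [∀ p, AddCommGroup (X p)] [∀ p, Module A (X p)]
    (f : ∀ p q, p ≤ q → (X p →ₗ[A] X q)) (hid : ∀ p x, f p p le_rfl x = x)
    (hcomp : ∀ p q r (h₁ : p ≤ q) (h₂ : q ≤ r) x, f p r (h₁.trans h₂) x = f q r h₂ (f p q h₁ x)) :
    PersistenceModule A m where
  obj p := ModuleCat.of A (X p)
  map {p q} g := ModuleCat.ofHom (f p q (leOfHom g))
  map_id p := by
    apply ModuleCat.hom_ext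
    ext x
    exact hid p x
  map_comp {p q r} g₁ g₂ := by
    apply ModuleCat.hom_ext
    ext x
    exact hcomp p q r (leOfHom g₁) (leOfHom g₂) x

/-- The copy of `A` or of `0`, as a submodule of `A`, that sits at index `p` of an interval module. -/
def intervalAt (A : Type) [CommRing A] (b d p : ℕ) : Submodule A A :=
  if b ≤ p ∧ p < d then ⊤ else ⊥

theorem mem_intervalAt {b d p : ℕ} {x : A} : x ∈ intervalAt A b d p ↔ (b ≤ p ∧ p < d) ∨ x = 0 := by
  unfold intervalAt
  split_ifs with h <;> simp [h]

/-- The interval module: `A` at the indices `b ≤ p < d`, zero elsewhere; its structure map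
`p ≤ q` is the identity of `A` if `b ≤ p ≤ q < d`, and zero otherwise. -/
def interval (A : Type) [CommRing A] (m b d : ℕ) : PersistenceModule A m :=
  mk' (fun p => ↥(intervalAt A b d p.val))
    (fun p q h =>
      if hpq : b ≤ p.val ∧ q.val < d then
        Submodule.inclusion fun _ _ =>
          mem_intervalAt.2 (Or.inl ⟨hpq.1.trans (Fin.le_def.1 h), hpq.2⟩)
      else 0)
    (fun p x => by
      by_cases hp : b ≤ p.val ∧ p.val < d
      · rw [dif_pos hp]; rfl
      · rw [dif_neg hp]
        exact Subtype.ext ((mem_intervalAt.1 x.2).resolve_left hp).symm)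
    (fun p q r h₁ h₂ x => by
      have h₁' : p.val ≤ q.val := h₁
      have h₂' : q.val ≤ r.val := h₂
      by_cases hpr : b ≤ p.val ∧ r.val < d
      · rw [dif_pos hpr, dif_pos ⟨hpr.1.trans h₁', hpr.2⟩, dif_pos ⟨hpr.1, h₂'.trans_lt hpr.2⟩]
        rfl
      · rw [dif_neg hpr]
        by_cases hpq : b ≤ p.val ∧ q.val < d
        · rw [dif_neg (c := b ≤ q.val ∧ r.val < d) (fun h => hpr ⟨hpq.1, h.2⟩)]
          rfl
        · rw [dif_neg hpq]
          exact (map_zero _).symm)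

/-- `F` is isomorphic to an interval module `I^{b,d}` with `0 ≤ b < d`; the value `d = m + 1`
stands for an interval that reaches the last index `m`. -/
def IsInterval (F : PersistenceModule A m) : Prop :=
  ∃ b d : ℕ, b < d ∧ d ≤ m + 1 ∧ Nonempty (F ≅ interval A m b d)

/-- The (pointwise) direct sum of persistence modules. -/
def directSum {ι : Type} (F : ι → PersistenceModule A m) : PersistenceModule A m :=
  mk' (fun p => DirectSum ι fun i => (F i).obj p)
    (fun _ _ h => DirectSum.lmap fun i => (F i).str h)
    (fun p x => by
      refine DFinsupp.ext fun i => ?_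
      change ((F i).map (𝟙 p)).hom (x i) = x i
      rw [(F i).map_id]
      rfl)
    (fun p q r h₁ h₂ x => by
      refine DFinsupp.ext fun i => ?_
      change ((F i).map (homOfLE (h₁.trans h₂))).hom (x i)
        = ((F i).map (homOfLE h₂)).hom (((F i).map (homOfLE h₁)).hom (x i))
      rw [← homOfLE_comp h₁ h₂, (F i).map_comp]
      rfl)

/-- `F` splits as a (finite) direct sum of interval modules. -/
def SplitsIntoIntervals (F : PersistenceModule A m) : Prop :=
  ∃ (n : ℕ) (G : Fin n → PersistenceModule A m),
    (∀ i, (G i).IsInterval) ∧ Nonempty (F ≅ directSum G)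

/-- Persistence submodules: submodules of each `F_p` preserved by the structure maps. -/
@[ext]
structure Sub (F : PersistenceModule A m) where
  carrier : ∀ p, Submodule A (F.obj p)
  str_mem : ∀ {p q : Fin (m + 1)} (h : p ≤ q) {x : F.obj p}, x ∈ carrier p → F.str h x ∈ carrier q

namespace Sub

variable {F : PersistenceModule A m}

/-- A persistence submodule as a persistence module. -/
def toModule (N : Sub F) : PersistenceModule A m :=
  mk' (fun p => ↥(N.carrier p)) (fun _ _ h => (F.str h).restrict fun _ hx => N.str_mem h hx)
    (fun p x => by
      apply Subtype.ext
      change (F.map (𝟙 p)).hom x.1 = x.1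
      rw [F.map_id]
      rfl)
    (fun p q r h₁ h₂ x => by
      apply Subtype.ext
      change (F.map (homOfLE (h₁.trans h₂))).hom x.1
        = (F.map (homOfLE h₂)).hom ((F.map (homOfLE h₁)).hom x.1)
      rw [← homOfLE_comp h₁ h₂, F.map_comp]
      rfl)

/-- The intersection of a set of persistence submodules. -/
def inter (S : Set (Sub F)) : Sub F where
  carrier p := ⨅ N ∈ S, N.carrier p
  str_mem h x hx := by
    simp only [Submodule.mem_iInf] at hx ⊢
    exact fun N hN => N.str_mem h (hx N hN)

/-- The smallest persistence submodule of `F` that contains the element `x` of `F_p`. -/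
def generatedBy {p : Fin (m + 1)} (x : F.obj p) : Sub F := inter {N | x ∈ N.carrier p}

/-- `F` is the internal direct sum of the family of persistence submodules `N`. -/
def IsDirectSum {ι : Type} [DecidableEq ι] (N : ι → Sub F) : Prop :=
  ∀ p, DirectSum.IsInternal fun i => (N i).carrier p

end Sub

end PersistenceModule

/-! ### Standard-form chain complexes -/

/-- The subgroup of `ℤ^m` spanned by the standard unit vectors `σ_j` with `j ∈ s`. -/
def coordSpan {m : ℕ} (s : Set (Fin m)) : Submodule ℤ (Fin m → ℤ) :=
  Submodule.span ℤ ((fun j => Pi.single j 1) '' s)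

theorem mem_coordSpan {m : ℕ} {s : Set (Fin m)} {x : Fin m → ℤ} :
    x ∈ coordSpan s ↔ ∀ j, j ∉ s → x j = 0 := by
  constructor
  · intro hx j hj
    induction hx using Submodule.span_induction with
    | mem y hy =>
      obtain ⟨i, hi, rfl⟩ := hy
      refine Pi.single_eq_of_ne ?_ _
      rintro rfl
      exact hj hi
    | zero => rfl
    | add y z _ _ hy hz => simp [hy, hz]
    | smul a y _ hy => simp [hy]
  · intro hx
    rw [pi_eq_sum_univ' x]
    refine Submodule.sum_mem _ fun j _ => ?_
    by_cases hj : j ∈ s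
    · exact Submodule.smul_mem _ _ (Submodule.subset_span ⟨j, hj, rfl⟩)
    · rw [hx j hj, zero_smul]
      exact Submodule.zero_mem _

/-- A standard-form chain complex on `C = ℤ^m`: the unit vector `σ_j` is homogeneous of degree
`deg j`, so that `C_k` is spanned by the `σ_j` of degree `k`; the differential, with matrix `D`,
maps `C_k` to `C_{k-1}` and squares to zero; and the span of `σ_1, …, σ_p` is a subcomplex for
every `p`. (The unit vector `σ_p` has index `p - 1` in `Fin m`.) -/
structure StandardFormComplex (m : ℕ) where
  deg : Fin m → ℤ
  D : Matrix (Fin m) (Fin m) ℤ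
  D_degree : ∀ k : ℤ, ∀ x ∈ coordSpan {j | deg j = k}, D.mulVecLin x ∈ coordSpan {j | deg j = k - 1}
  D_sq : ∀ x, D.mulVecLin (D.mulVecLin x) = 0
  D_filtration : ∀ p ≤ m, ∀ x ∈ coordSpan {j | j.val < p}, D.mulVecLin x ∈ coordSpan {j | j.val < p}

namespace StandardFormComplex

variable {m : ℕ} (C : StandardFormComplex m)

/-- The group `C_k` of `k`-chains. -/
def chains (k : ℤ) : Submodule ℤ (Fin m → ℤ) := coordSpan {j | C.deg j = k}

/-- The canonical filtration: `K_p` is spanned by the first `p` unit vectors. -/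
def K (_ : StandardFormComplex m) (p : Fin (m + 1)) : Submodule ℤ (Fin m → ℤ) :=
  coordSpan {j | j.val < p.val}

theorem K_mono {p q : Fin (m + 1)} (h : p ≤ q) : C.K p ≤ C.K q :=
  Submodule.span_mono (Set.image_mono fun _ hj => lt_of_lt_of_le (Set.mem_ofPred.1 hj) (Fin.le_def.1 h))

theorem mem_K_last (z : Fin m → ℤ) : z ∈ C.K (Fin.last m) :=
  mem_coordSpan.2 fun j hj => absurd j.isLt hj

/-- The `k`-cycles of `C`. -/
def cycles (k : ℤ) : Submodule ℤ (Fin m → ℤ) := C.chains k ⊓ LinearMap.ker C.D.mulVecLin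

/-- The `k`-cycles of the subcomplex `K_p`. -/
def cyclesIn (k : ℤ) (p : Fin (m + 1)) : Submodule ℤ (Fin m → ℤ) := C.cycles k ⊓ C.K p

/-- The `k`-boundaries of the subcomplex `K_p`. -/
def boundariesIn (k : ℤ) (p : Fin (m + 1)) : Submodule ℤ (Fin m → ℤ) :=
  (C.chains (k + 1) ⊓ C.K p).map C.D.mulVecLin

theorem cyclesIn_mono (k : ℤ) {p q : Fin (m + 1)} (h : p ≤ q) :
    C.cyclesIn k p ≤ C.cyclesIn k q :=
  inf_le_inf_left _ (C.K_mono h)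

theorem boundariesIn_mono (k : ℤ) {p q : Fin (m + 1)} (h : p ≤ q) :
    C.boundariesIn k p ≤ C.boundariesIn k q :=
  Submodule.map_mono (inf_le_inf_left _ (C.K_mono h))

theorem boundariesIn_le_cyclesIn (k : ℤ) (p : Fin (m + 1)) :
    C.boundariesIn k p ≤ C.cyclesIn k p := by
  rintro _ ⟨x, ⟨hx, hxp⟩, rfl⟩
  refine ⟨⟨?_, C.D_sq x⟩, C.D_filtration p (Nat.le_of_lt_succ p.isLt) x hxp⟩
  have h := C.D_degree (k + 1) x hx
  rwa [add_sub_cancel_right] at h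

/-- The group `H_k(K_p; ℤ)`: cycles modulo boundaries. -/
abbrev H (k : ℤ) (p : Fin (m + 1)) : Type :=
  ↥(C.cyclesIn k p) ⧸ (C.boundariesIn k p).submoduleOf (C.cyclesIn k p)

/-- The persistence module `H_k(K; ℤ)`, with structure maps induced by inclusion. -/
def homology (k : ℤ) : PersistenceModule ℤ m :=
  PersistenceModule.mk' (C.H k)
    (fun _ _ h => Submodule.mapQ _ _ (Submodule.inclusion (C.cyclesIn_mono k h))
      fun _ hx => C.boundariesIn_mono k h hx)
    (fun p x => by
      obtain ⟨z, rfl⟩ := Submodule.Quotient.mk_surjective _ x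
      rfl)
    (fun p q r h₁ h₂ x => by
      obtain ⟨z, rfl⟩ := Submodule.Quotient.mk_surjective _ x
      rfl)

open Classical in
/-- The smallest `p` such that `z ∈ K_p`. -/
noncomputable def birth (z : Fin m → ℤ) : Fin (m + 1) :=
  Fin.find (fun p => z ∈ C.K p) ⟨Fin.last m, C.mem_K_last z⟩

theorem mem_K_birth (z : Fin m → ℤ) : z ∈ C.K (C.birth z) := by
  classical
  exact Fin.find_spec (p := fun p => z ∈ C.K p) ⟨Fin.last m, C.mem_K_last z⟩

/-- The principal submodule `P(z)` of `H_k(K; ℤ)` generated by a `k`-cycle `z`: the smallest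
persistence submodule that contains the class of `z` in `H_k(K_p; ℤ)`, where `p` is the smallest
index with `z ∈ K_p`. -/
noncomputable def principal (k : ℤ) (z : Fin m → ℤ) (hz : z ∈ C.cycles k) :
    (C.homology k).Sub :=
  PersistenceModule.Sub.generatedBy (F := C.homology k) (p := C.birth z)
    (Submodule.Quotient.mk (⟨z, hz, C.mem_K_birth z⟩ : ↥(C.cyclesIn k (C.birth z))))

/-- The boundary matrix with rational coefficients. -/
def DQ : Matrix (Fin m) (Fin m) ℚ := C.D.map fun a => (a : ℚ)

/-- The matrix `R` of the decomposition `R = DV` returned by the standard algorithm. -/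
def R : Matrix (Fin m) (Fin m) ℚ := (StdReduction.standardAlgorithm C.DQ).1

/-- The matrix `V` of the decomposition `R = DV` returned by the standard algorithm. -/
def V : Matrix (Fin m) (Fin m) ℚ := (StdReduction.standardAlgorithm C.DQ).2

/-- The matrix `J`. -/
noncomputable def J : Matrix (Fin m) (Fin m) ℚ := StdReduction.matchingBasis C.R C.V

/-- The matrix `M = J⁻¹ D J`. -/
noncomputable def M : Matrix (Fin m) (Fin m) ℚ := C.J⁻¹ * C.DQ * C.J

/-- The indices `j` of the columns of `J` that enter the decomposition of `H_k(K; ℤ)`: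
`σ_j ∈ C_k` and `Col_j(M) = 0`. -/
def E (k : ℤ) : Set (Fin m) := {j | Pi.single j 1 ∈ C.chains k ∧ ∀ i, C.M i j = 0}

end StandardFormComplex

/-! ### Columns with distinct last rows, and unitriangular matrices. -/

namespace StdReduction

variable {m : ℕ}

/-! Let T be the matrix that keeps only the trailing entries of R. Over ℚ one always has D J = J T,
so M = T (`DQ_mul_J`, `M_eq`). The point that needs D² = 0 is that a row in which a column of R ends
indexes a zero column of R (`standardAlgorithm_col_eq_zero`). Moreover J is unitriangular and
homogeneous, so its columns form a basis adapted to the grading and the filtration, in which the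
differential matches basis vectors in pairs.

If the trailing coefficients are ±1, every quotient formed by the algorithm is an integer. Hence J
and T are integral and the matching exists over ℤ (`exists_isMatchingBasis`). Homology can then be
read off: cycles are the combinations of the columns j with T-column zero. Such a column is born
with j and, if it is matched with r, dies when r enters, no nonzero multiple dying earlier. This
gives the intervals and the direct sum (`isInterval_principal`, `isDirectSum_principal`), and hence
an abstract splitting.

Conversely, a sum of intervals has structure maps with torsion-free cokernels
(`SplitsIntoIntervals.isPure`). Take the first column r of R whose trailing coefficient c, in row i,
is not yet known to be a unit. All earlier ones are units, so columns i and r of V and column r of R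
are integral. Column i of V is a cycle x with last entry 1, column r of R is a boundary z, and c x -
z lives before i. So c[x] comes from an earlier index, and purity makes [x] itself come from there:
x - w = D y with y integral and w supported before row i. Comparing entries in row i gives c · y_r =
1 (`trailing_of_isPure`). -/

theorem low_eq_succ_iff {R : Matrix (Fin m) (Fin m) ℚ} {i j : Fin m} :
    low R j = i.val + 1 ↔ R i j ≠ 0 ∧ ∀ i', i < i' → R i' j = 0 := by
  constructor
  · intro h
    have hpos : 0 < low R j := by omega
    have hi : lowIndex R j hpos = i := Fin.ext (by simp [lowIndex, h])
    exact ⟨hi ▸ lowIndex_ne_zero R j hpos,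
      fun i' hi' => eq_zero_of_low_le (h.trans_le (Fin.lt_def.1 hi'))⟩
  · rintro ⟨h, h'⟩
    refine le_antisymm (Finset.sup_le fun i' hi' => ?_) (lt_low h)
    by_contra hlt
    exact (Finset.mem_filter.1 hi').2 (h' i' (Fin.lt_def.2 (by omega)))

theorem exists_low_eq_succ {R : Matrix (Fin m) (Fin m) ℚ} {j : Fin m} (h : 0 < low R j) :
    ∃ i : Fin m, low R j = i.val + 1 :=
  ⟨lowIndex R j h, by simp only [lowIndex]; omega⟩

theorem low_pos_iff {R : Matrix (Fin m) (Fin m) ℚ} {j : Fin m} :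
    0 < low R j ↔ ∃ i, R i j ≠ 0 :=
  ⟨fun h => ⟨_, lowIndex_ne_zero R j h⟩, fun ⟨_, hi⟩ => Nat.zero_lt_of_lt (lt_low hi)⟩

theorem trailing_eq {R : Matrix (Fin m) (Fin m) ℚ} {i j : Fin m} (h : low R j = i.val + 1) :
    trailing R j = R i j := by
  have hpos : 0 < low R j := by omega
  rw [trailing, dif_pos hpos]
  congr 1
  exact Fin.ext (by simp [lowIndex, h])

theorem trailing_ne_zero {R : Matrix (Fin m) (Fin m) ℚ} {i j : Fin m} (h : low R j = i.val + 1) :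
    trailing R j ≠ 0 := by
  rw [trailing_eq h]
  exact (low_eq_succ_iff.1 h).1

theorem low_congr {A B : Matrix (Fin m) (Fin m) ℚ} {j : Fin m} (h : ∀ i, A i j = B i j) :
    low A j = low B j := by
  simp only [low, h]

theorem trailing_congr {A B : Matrix (Fin m) (Fin m) ℚ} {j : Fin m} (h : ∀ i, A i j = B i j) :
    trailing A j = trailing B j := by
  simp only [trailing, low_congr h, h, lowIndex]

/-- The nonzero columns of `R` end in pairwise different rows. -/
def IsReduced (R : Matrix (Fin m) (Fin m) ℚ) : Prop :=
  ∀ j j', 0 < low R j → low R j = low R j' → j = j'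

namespace IsReduced

variable {R : Matrix (Fin m) (Fin m) ℚ} (hR : IsReduced R)
include hR

/-- Columns ending above row `l` vanish there, those ending below carry coefficient zero by `ha`,
and by reducedness no second column ends in row `l`. -/
theorem mulVec_apply_of_low_eq {a : Fin m → ℚ} {l j : Fin m} (hl : low R j = l.val + 1)
    (ha : ∀ j', l.val + 1 < low R j' → a j' = 0) : (R.mulVec a) l = R l j * a j := by
  refine Finset.sum_eq_single_of_mem j (Finset.mem_univ _) fun j' _ hj' => ?_
  change R l j' * a j' = 0
  rcases lt_trichotomy (low R j') (l.val + 1) with h | h | h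
  · rw [eq_zero_of_low_le (Nat.le_of_lt_succ h), zero_mul]
  · exact absurd (hR j' j (by omega) (by omega)) hj'
  · rw [ha j' h, mul_zero]

/-- Columns with distinct last rows cannot cancel each other's last entries. The recursion treats
the lowest-ending columns first, which reduces row `l` to a single product. -/
theorem coeff_eq_zero {a : Fin m → ℚ} {n : ℕ} (h : ∀ i : Fin m, n ≤ i.val → R.mulVec a i = 0)
    (j : Fin m) (hj : n < low R j) : a j = 0 := by
  obtain ⟨l, hl⟩ := exists_low_eq_succ (Nat.zero_lt_of_lt hj)
  have key := mulVec_apply_of_low_eq hR hl fun j' hj' => coeff_eq_zero h j' (by omega)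
  rw [h l (by omega)] at key
  exact (mul_eq_zero.1 key.symm).resolve_left (low_eq_succ_iff.1 hl).1
termination_by m - low R j
decreasing_by have := low_le R j'; omega

end IsReduced

/-- Upper triangular matrices with ones on the diagonal. -/
def IsUnitriangular {A : Type*} [CommRing A] (V : Matrix (Fin m) (Fin m) A) : Prop :=
  (∀ i j, j < i → V i j = 0) ∧ ∀ j, V j j = 1

namespace IsUnitriangular

theorem det {A : Type*} [CommRing A] {V : Matrix (Fin m) (Fin m) A} (hV : IsUnitriangular V) :
    V.det = 1 := by
  rw [Matrix.det_of_isUpperTriangular fun i j h => hV.1 i j h]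
  simp [hV.2]

theorem exists_mulVec_eq {A : Type*} [CommRing A] {V : Matrix (Fin m) (Fin m) A}
    (hV : IsUnitriangular V) (x : Fin m → A) : ∃ a, V.mulVec a = x :=
  ⟨V⁻¹.mulVec x, by
    rw [Matrix.mulVec_mulVec, Matrix.mul_nonsing_inv _ (hV.det ▸ isUnit_one), Matrix.one_mulVec]⟩

theorem mulVec_injective {A : Type*} [CommRing A] {V : Matrix (Fin m) (Fin m) A}
    (hV : IsUnitriangular V) : Function.Injective V.mulVec :=
  Matrix.mulVec_injective_of_isUnit ((Matrix.isUnit_iff_isUnit_det _).2 (hV.det ▸ isUnit_one))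

variable {V : Matrix (Fin m) (Fin m) ℚ} (hV : IsUnitriangular V)
include hV

theorem low_eq (j : Fin m) : low V j = j.val + 1 :=
  low_eq_succ_iff.2 ⟨by simp [hV.2], fun i' h => hV.1 i' j h⟩

theorem isReduced : IsReduced V := fun j j' _ h => by
  rw [hV.low_eq, hV.low_eq] at h
  exact Fin.ext (by omega)

theorem coeff_eq_zero {a : Fin m → ℚ} {n : ℕ} (h : ∀ i : Fin m, n ≤ i.val → V.mulVec a i = 0)
    (j : Fin m) (hj : n ≤ j.val) : a j = 0 :=
  hV.isReduced.coeff_eq_zero h j (by rw [hV.low_eq]; omega)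

theorem mulVec_apply_last {a : Fin m → ℚ} {l : Fin m} (h : ∀ i, l < i → V.mulVec a i = 0) :
    V.mulVec a l = a l := by
  rw [hV.isReduced.mulVec_apply_of_low_eq (hV.low_eq l), hV.2, one_mul]
  intro j hj
  exact hV.isReduced.coeff_eq_zero (n := l.val + 1) (fun i hi => h i (Fin.lt_def.2 hi)) j hj

end IsUnitriangular

/-! ### The standard algorithm -/

theorem colSub_apply_ne {A : Matrix (Fin m) (Fin m) ℚ} {j j' k : Fin m} {c : ℚ} (h : k ≠ j)
    (i : Fin m) : colSub A j c j' i k = A i k :=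
  Matrix.updateCol_ne h

theorem colSub_apply_self {A : Matrix (Fin m) (Fin m) ℚ} {j j' : Fin m} {c : ℚ}
    (i : Fin m) : colSub A j c j' i j = A i j - c * A i j' :=
  Matrix.updateCol_self

theorem mul_colSub (D A : Matrix (Fin m) (Fin m) ℚ) (j : Fin m) (c : ℚ) (j' : Fin m) :
    D * colSub A j c j' = colSub (D * A) j c j' := by
  ext i k
  by_cases h : k = j
  · subst h
    simp only [Matrix.mul_apply, colSub_apply_self, mul_sub, Finset.sum_sub_distrib,
      Finset.mul_sum, mul_left_comm]
  · simp only [Matrix.mul_apply, colSub_apply_ne h]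

/-- A property of the pair `(R, V)` that is preserved by the column operations of the inner loop
is preserved by the inner loop. -/
theorem reduceColumn_induction {j : Fin m}
    {P : Matrix (Fin m) (Fin m) ℚ × Matrix (Fin m) (Fin m) ℚ → Prop}
    (step : ∀ s j', Guard s.1 j j' → P s →
      P (colSub s.1 j (trailing s.1 j / trailing s.1 j') j',
        colSub s.2 j (trailing s.1 j / trailing s.1 j') j'))
    (s : Matrix (Fin m) (Fin m) ℚ × Matrix (Fin m) (Fin m) ℚ) (hs : P s) :
    P (reduceColumn j s) := by
  induction s using reduceColumn.induct j with
  | case1 s h ih =>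
    rw [reduceColumn, dif_pos h]
    exact ih (step s _ (Fin.find_spec h) hs)
  | case2 s h =>
    rw [reduceColumn, dif_neg h]
    exact hs

theorem reduceColumn_not_guard (j : Fin m)
    (s : Matrix (Fin m) (Fin m) ℚ × Matrix (Fin m) (Fin m) ℚ) (j' : Fin m) :
    ¬ Guard (reduceColumn j s).1 j j' := by
  induction s using reduceColumn.induct j with
  | case1 s h ih =>
    rw [reduceColumn, dif_pos h]
    exact ih
  | case2 s h =>
    rw [reduceColumn, dif_neg h]
    exact fun hg => h ⟨j', hg⟩

theorem reduceColumn_apply_ne {j k : Fin m} (hk : k ≠ j)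
    (s : Matrix (Fin m) (Fin m) ℚ × Matrix (Fin m) (Fin m) ℚ) (i : Fin m) :
    (reduceColumn j s).1 i k = s.1 i k ∧ (reduceColumn j s).2 i k = s.2 i k := by
  refine reduceColumn_induction (P := fun t => t.1 i k = s.1 i k ∧ t.2 i k = s.2 i k)
    (fun t j' _ ht => ?_) s ⟨rfl, rfl⟩
  simpa only [colSub_apply_ne hk] using ht

/-- The pair `(R, V)` of the standard algorithm when the first `n` columns are reduced. -/
def stage (D : Matrix (Fin m) (Fin m) ℚ) (n : ℕ) :
    Matrix (Fin m) (Fin m) ℚ × Matrix (Fin m) (Fin m) ℚ :=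
  ((List.finRange m).take n).foldl (fun s j => reduceColumn j s) (D, 1)

theorem stage_self (D : Matrix (Fin m) (Fin m) ℚ) : stage D m = standardAlgorithm D := by
  rw [stage, standardAlgorithm, List.take_of_length_le (by simp)]

theorem stage_succ (D : Matrix (Fin m) (Fin m) ℚ) (j : Fin m) :
    stage D (j.val + 1) = reduceColumn j (stage D j.val) := by
  rw [stage, List.take_add_one, List.foldl_append]
  simp [stage]

theorem stage_induction {D : Matrix (Fin m) (Fin m) ℚ}
    {P : Matrix (Fin m) (Fin m) ℚ × Matrix (Fin m) (Fin m) ℚ → Prop} (init : P (D, 1))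
    (step : ∀ j s j', Guard s.1 j j' → P s →
      P (colSub s.1 j (trailing s.1 j / trailing s.1 j') j',
        colSub s.2 j (trailing s.1 j / trailing s.1 j') j')) :
    P (standardAlgorithm D) :=
  List.foldlRecOn _ _ init fun s hs j _ => reduceColumn_induction (step j) s hs

theorem stage_apply_of_le (D : Matrix (Fin m) (Fin m) ℚ) {n : ℕ} {k : Fin m} (h : n ≤ k.val)
    (i : Fin m) : (stage D n).1 i k = D i k ∧
      (stage D n).2 i k = (1 : Matrix (Fin m) (Fin m) ℚ) i k := by
  induction n with
  | zero => simp [stage]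
  | succ n ih =>
    have hs := stage_succ D ⟨n, by omega⟩
    have hk : k ≠ ⟨n, by omega⟩ := fun e => by simp [e] at h
    rw [hs, (reduceColumn_apply_ne hk _ i).1, (reduceColumn_apply_ne hk _ i).2]
    exact ih (by omega)

/-- Each column is altered only during its own step, so descending from the final stage changes
nothing in column `k`. -/
theorem stage_apply_of_lt (D : Matrix (Fin m) (Fin m) ℚ) {n : ℕ} (hn : n ≤ m) {k : Fin m}
    (h : k.val < n) (i : Fin m) : (stage D n).1 i k = (standardAlgorithm D).1 i k ∧
      (stage D n).2 i k = (standardAlgorithm D).2 i k := by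
  induction hn using Nat.decreasingInduction with
  | self => simp [stage_self]
  | of_succ n hn ih =>
    have hs := stage_succ D ⟨n, hn⟩
    have hk : k ≠ ⟨n, hn⟩ := fun e => by simp [e] at h
    have := ih (by omega)
    rw [hs, (reduceColumn_apply_ne hk _ i).1, (reduceColumn_apply_ne hk _ i).2] at this
    exact this

section Output

variable (D : Matrix (Fin m) (Fin m) ℚ)

theorem standardAlgorithm_eq_mul : (standardAlgorithm D).1 = D * (standardAlgorithm D).2 := by
  refine stage_induction (P := fun s => s.1 = D * s.2) (by simp) fun j s j' _ hs => ?_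
  rw [mul_colSub, ← hs]

theorem standardAlgorithm_unitriangular : IsUnitriangular (standardAlgorithm D).2 := by
  refine stage_induction (P := fun s => IsUnitriangular s.2)
    ⟨fun i j h => Matrix.one_apply_ne h.ne', fun j => Matrix.one_apply_eq j⟩ fun j s j' hg hs => ?_
  -- The subtracted column `j'` of V lies strictly left of `j`, so it vanishes from row `j` on.
  have key : ∀ i, j ≤ i → colSub s.2 j (trailing s.1 j / trailing s.1 j') j' i j = s.2 i j := by
    intro i hi
    rw [colSub_apply_self, hs.1 i j' (hg.1.trans_le hi), mul_zero, sub_zero]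
  constructor
  · intro i k hk
    by_cases h : k = j
    · subst h
      exact (key i hk.le).trans (hs.1 i k hk)
    · exact (colSub_apply_ne h i).trans (hs.1 i k hk)
  · intro k
    by_cases h : k = j
    · subst h
      exact (key k le_rfl).trans (hs.2 k)
    · exact (colSub_apply_ne h k).trans (hs.2 k)

theorem standardAlgorithm_reduced : IsReduced (standardAlgorithm D).1 := by
  -- When the loop on the later column stops, both columns already have their final form, and the
  -- failed guard says that they do not share a last row.
  have key : ∀ j j', 0 < low (standardAlgorithm D).1 j →
      low (standardAlgorithm D).1 j = low (standardAlgorithm D).1 j' → ¬ j' < j := by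
    intro j j' hpos heq hlt
    have h1 : low (standardAlgorithm D).1 j = low (stage D (j.val + 1)).1 j :=
      low_congr fun i => (stage_apply_of_lt D j.isLt (by omega) i).1.symm
    have h2 : low (standardAlgorithm D).1 j' = low (stage D (j.val + 1)).1 j' :=
      low_congr fun i => (stage_apply_of_lt D j.isLt (by have := Fin.lt_def.1 hlt; omega) i).1.symm
    rw [stage_succ] at h1 h2
    exact reduceColumn_not_guard j (stage D j.val) j' ⟨hlt, h1 ▸ hpos, by rw [← h1, ← h2, heq]⟩
  intro j j' hpos heq
  exact le_antisymm (not_lt.1 (key j j' hpos heq)) (not_lt.1 (key j' j (heq ▸ hpos) heq.symm))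

/-- If `D` is homogeneous of degree `-1` for a grading of the unit vectors, then `V` is homogeneous
of degree `0`. -/
theorem standardAlgorithm_degree {D : Matrix (Fin m) (Fin m) ℚ} {deg : Fin m → ℤ}
    (hD : ∀ i j, D i j ≠ 0 → deg i = deg j - 1) (i j : Fin m)
    (h : (standardAlgorithm D).2 i j ≠ 0) : deg i = deg j := by
  have key := stage_induction (D := D) (P := fun s => (∀ i j, s.1 i j ≠ 0 → deg i = deg j - 1) ∧
    ∀ i j, s.2 i j ≠ 0 → deg i = deg j) ⟨hD, fun i j h => by
      by_contra hne
      exact h (Matrix.one_apply_ne fun e => hne (by rw [e]))⟩ ?_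
  · exact key.2 i j h
  · intro j s j' ⟨_, hpos, hlow⟩ ⟨h1, h2⟩
    obtain ⟨l, hl⟩ := exists_low_eq_succ hpos
    have e1 := h1 _ _ (low_eq_succ_iff.1 hl).1
    have e2 := h1 _ _ (low_eq_succ_iff.1 (hlow.trans hl)).1
    -- The two columns have a nonzero entry in the same row `l`, which fixes both degrees.
    have hdeg : deg j' = deg j := by omega
    -- One statement for both matrices: the shift `d` is 1 for R and 0 for V.
    have hcol : ∀ (A : Matrix (Fin m) (Fin m) ℚ) (d : ℤ), (∀ i k, A i k ≠ 0 → deg i = deg k - d) →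
        ∀ c i k, colSub A j c j' i k ≠ 0 → deg i = deg k - d := by
      intro A d hA c i k hne
      by_cases hk : k = j
      · subst hk
        by_cases h0 : A i k = 0
        · rw [colSub_apply_self, h0, zero_sub, neg_ne_zero] at hne
          rw [← hdeg]
          exact hA i j' (right_ne_zero_of_mul hne)
        · exact hA i k h0
      · rw [colSub_apply_ne hk] at hne
        exact hA i k hne
    exact ⟨hcol _ 1 h1 _, fun i k hne => by
      simpa using hcol _ 0 (fun i k h => by simpa using h2 i k h) _ i k hne⟩

/-- Column `j` of `A` has integer entries. -/
def IsIntegralCol (A : Matrix (Fin m) (Fin m) ℚ) (j : Fin m) : Prop :=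
  ∀ i, ∃ a : ℤ, (a : ℚ) = A i j

theorem IsIntegralCol.congr {A B : Matrix (Fin m) (Fin m) ℚ} {j : Fin m} (hA : IsIntegralCol A j)
    (h : ∀ i, A i j = B i j) : IsIntegralCol B j := fun i => by
  rw [← h]
  exact hA i

theorem IsIntegralCol.colSub {A : Matrix (Fin m) (Fin m) ℚ} {j j' : Fin m} {c : ℤ}
    (h : IsIntegralCol A j) (h' : IsIntegralCol A j') :
    IsIntegralCol (colSub A j (c : ℚ) j') j := fun i => by
  obtain ⟨a, ha⟩ := h i
  obtain ⟨b, hb⟩ := h' i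
  exact ⟨a - c * b, by rw [colSub_apply_self, ← ha, ← hb]; push_cast; rfl⟩

theorem reduceColumn_integral {j : Fin m}
    {s : Matrix (Fin m) (Fin m) ℚ × Matrix (Fin m) (Fin m) ℚ}
    (hs : ∀ k ≤ j, IsIntegralCol s.1 k ∧ IsIntegralCol s.2 k)
    (ht : ∀ k < j, 0 < low s.1 k → trailing s.1 k = 1 ∨ trailing s.1 k = -1) :
    IsIntegralCol (reduceColumn j s).1 j ∧ IsIntegralCol (reduceColumn j s).2 j := by
  have key := reduceColumn_induction (j := j)
    (P := fun s => (∀ k ≤ j, IsIntegralCol s.1 k ∧ IsIntegralCol s.2 k) ∧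
      ∀ k < j, 0 < low s.1 k → trailing s.1 k = 1 ∨ trailing s.1 k = -1) ?_ s ⟨hs, ht⟩
  · exact key.1 j le_rfl
  · rintro s j' ⟨hlt, hpos, hlow⟩ ⟨hs, ht⟩
    obtain ⟨c, hc⟩ : ∃ c : ℤ, (c : ℚ) = trailing s.1 j / trailing s.1 j' := by
      obtain ⟨l, hl⟩ := exists_low_eq_succ hpos
      obtain ⟨a, ha⟩ := (hs j le_rfl).1 l
      rw [trailing_eq hl, ← ha]
      rcases ht j' hlt (hlow ▸ hpos) with h | h <;> rw [h]
      · exact ⟨a, by simp⟩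
      · exact ⟨-a, by simp [div_neg]⟩
    rw [← hc]
    refine ⟨fun k hk => ?_, fun k hk => ?_⟩
    · by_cases h : k = j
      · subst h
        exact ⟨(hs k le_rfl).1.colSub (hs j' hlt.le).1, (hs k le_rfl).2.colSub (hs j' hlt.le).2⟩
      · exact ⟨(hs k hk).1.congr fun i => (colSub_apply_ne h i).symm,
          (hs k hk).2.congr fun i => (colSub_apply_ne h i).symm⟩
    · have e : ∀ i, colSub s.1 j (c : ℚ) j' i k = s.1 i k := colSub_apply_ne hk.ne
      simpa only [low_congr e, trailing_congr e] using ht k hk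

/-- Only columns strictly before `j` need unit trailing coefficients, because only they are divided
by. The converse direction relies on this: a column is integral before anything is known about its
own trailing coefficient. -/
theorem standardAlgorithm_integral {D : Matrix (Fin m) (Fin m) ℚ}
    (hD : ∀ j, IsIntegralCol D j) (j : Fin m)
    (ht : ∀ k < j, 0 < low (standardAlgorithm D).1 k →
      trailing (standardAlgorithm D).1 k = 1 ∨ trailing (standardAlgorithm D).1 k = -1) :
    IsIntegralCol (standardAlgorithm D).1 j ∧ IsIntegralCol (standardAlgorithm D).2 j := by
  induction j using WellFoundedLT.induction with
  | ind j ih =>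
  have hlt : ∀ k < j, ∀ i, (stage D j.val).1 i k = (standardAlgorithm D).1 i k ∧
      (stage D j.val).2 i k = (standardAlgorithm D).2 i k := fun k hk =>
    stage_apply_of_lt D j.isLt.le hk
  have key := reduceColumn_integral (j := j) (s := stage D j.val) (fun k hk => ?_) fun k hk => ?_
  · rw [← stage_succ] at key
    have e := stage_apply_of_lt D (n := j.val + 1) j.isLt (k := j) (by omega)
    exact ⟨key.1.congr fun i => (e i).1, key.2.congr fun i => (e i).2⟩
  · rcases hk.lt_or_eq with hk | rfl
    · have := ih k hk fun k' hk' => ht k' (hk'.trans hk)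
      exact ⟨this.1.congr fun i => (hlt k hk i).1.symm, this.2.congr fun i => (hlt k hk i).2.symm⟩
    · have e := stage_apply_of_le D (n := k.val) (k := k) le_rfl
      refine ⟨(hD k).congr fun i => (e i).1.symm, fun i => ?_⟩
      rw [(e i).2, Matrix.one_apply]
      split_ifs
      · exact ⟨1, by simp⟩
      · exact ⟨0, by simp⟩
  · have e : ∀ i, (stage D j.val).1 i k = (standardAlgorithm D).1 i k := fun i => (hlt k hk i).1
    rw [low_congr e, trailing_congr e]
    exact ht k hk

/-- A row in which a column of `R` ends belongs to a zero column of `R` if `D² = 0`. -/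
theorem standardAlgorithm_col_eq_zero {D : Matrix (Fin m) (Fin m) ℚ} (hD : D * D = 0)
    {j r : Fin m} (h : low (standardAlgorithm D).1 r = j.val + 1) (i : Fin m) :
    (standardAlgorithm D).1 i j = 0 := by
  have hV := standardAlgorithm_unitriangular D
  -- Expand column `r` of R in the columns of V. Its last row is `j`, so `b j` is nonzero, while R b
  -- = D V b = D (column `r` of R) = 0 because D² = 0. Reducedness then allows `b j ≠ 0` only if
  -- column `j` of R is zero.
  obtain ⟨b, hb⟩ := hV.exists_mulVec_eq ((standardAlgorithm D).1.col r)
  obtain ⟨hne, hz⟩ := low_eq_succ_iff.1 h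
  have hbj : b j ≠ 0 := by
    rw [← hV.mulVec_apply_last (a := b) fun i hi => by rw [hb]; exact hz i hi, hb]
    exact hne
  have hRb : (standardAlgorithm D).1.mulVec b = 0 := by
    have : (standardAlgorithm D).1.col r = D.mulVec ((standardAlgorithm D).2.col r) := by
      rw [standardAlgorithm_eq_mul]; rfl
    rw [standardAlgorithm_eq_mul, ← Matrix.mulVec_mulVec, hb, this, Matrix.mulVec_mulVec, hD,
      Matrix.zero_mulVec]
  by_contra hij
  exact hbj ((standardAlgorithm_reduced D).coeff_eq_zero (n := 0) (fun i _ => by simp [hRb]) j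
    (low_pos_iff.2 ⟨i, hij⟩))

end Output

end StdReduction

/-! ### Structure maps, principal submodules and purity of persistence modules. -/

namespace PersistenceModule

variable {A : Type} [CommRing A] {m : ℕ}

section Str

variable (F : PersistenceModule A m)

theorem str_self {p : Fin (m + 1)} (h : p ≤ p) (x : F.obj p) : F.str h x = x := by
  change (F.map (𝟙 p)).hom x = x
  rw [F.map_id]
  rfl

theorem str_str {p q r : Fin (m + 1)} (h₁ : p ≤ q) (h₂ : q ≤ r) (x : F.obj p) :
    F.str h₂ (F.str h₁ x) = F.str (h₁.trans h₂) x := by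
  change _ = (F.map (homOfLE (h₁.trans h₂))).hom x
  rw [← homOfLE_comp h₁ h₂, F.map_comp]
  rfl

end Str

theorem str_naturality {F G : PersistenceModule A m} (f : F ⟶ G) {p q : Fin (m + 1)} (h : p ≤ q)
    (x : F.obj p) : (f.app q).hom (F.str h x) = G.str h ((f.app p).hom x) :=
  congrArg (fun g => g.hom x) (f.naturality (homOfLE h))

/-- A family of bijective linear maps that commute with the structure maps is an isomorphism. -/
theorem nonempty_iso {F G : PersistenceModule A m} (f : ∀ p, F.obj p →ₗ[A] G.obj p)
    (hf : ∀ p q (h : p ≤ q) x, f q (F.str h x) = G.str h (f p x))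
    (hb : ∀ p, Function.Bijective (f p)) : Nonempty (F ≅ G) :=
  ⟨NatIso.ofComponents (fun p => (LinearEquiv.ofBijective (f p) (hb p)).toModuleIso)
    fun {p q} g => ModuleCat.hom_ext (LinearMap.ext fun x => hf p q (leOfHom g) x)⟩

/-! ### Principal submodules -/

namespace Sub

variable {F : PersistenceModule A m}

theorem mem_generatedBy_of_le {p q : Fin (m + 1)} (x : F.obj p) (h : p ≤ q) {y : F.obj q} :
    y ∈ (generatedBy x).carrier q ↔ ∃ a : A, a • F.str h x = y := by
  simp only [generatedBy, inter, Submodule.mem_iInf]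
  constructor
  · intro hy
    -- The multiples of the images of `x` already form a persistence submodule; the spanning set is
    -- empty at indices not above `p`.
    let N : Sub F :=
      { carrier := fun r => Submodule.span A {z | ∃ hr : p ≤ r, F.str hr x = z}
        str_mem := fun {r s} hrs z hz => by
          induction hz using Submodule.span_induction with
          | mem z hz =>
            obtain ⟨hr, rfl⟩ := hz
            exact Submodule.subset_span ⟨hr.trans hrs, (F.str_str hr hrs x).symm⟩
          | zero => rw [map_zero]; exact Submodule.zero_mem _
          | add z w _ _ hz hw => rw [map_add]; exact Submodule.add_mem _ hz hw
          | smul a z _ hz => rw [map_smul]; exact Submodule.smul_mem _ a hz }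
    have hN : y ∈ N.carrier q := hy N (Submodule.subset_span ⟨le_rfl, F.str_self le_rfl x⟩)
    have hset : {z | ∃ hr : p ≤ q, F.str hr x = z} = {F.str h x} := by
      ext z
      exact ⟨fun ⟨_, hz⟩ => hz.symm, fun hz => ⟨h, Eq.symm hz⟩⟩
    change y ∈ Submodule.span A _ at hN
    rw [hset] at hN
    exact Submodule.mem_span_singleton.1 hN
  · rintro ⟨a, rfl⟩ N hN
    exact Submodule.smul_mem _ a (N.str_mem h hN)

theorem mem_generatedBy_of_not_le {p q : Fin (m + 1)} (x : F.obj p) (h : ¬ p ≤ q) {y : F.obj q} :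
    y ∈ (generatedBy x).carrier q ↔ y = 0 := by
  simp only [generatedBy, inter, Submodule.mem_iInf]
  constructor
  · intro hy
    -- The submodule that is everything from `p` on and zero elsewhere: the infimum over an empty
    -- index type is the whole module.
    let N : Sub F :=
      { carrier := fun r => ⨅ _ : ¬ p ≤ r, ⊥
        str_mem := fun {r s} hrs z hz => by
          simp only [Submodule.mem_iInf, Submodule.mem_bot] at hz ⊢
          intro hs
          rw [hz fun hr => hs (hr.trans hrs), map_zero] }
    have hN : y ∈ N.carrier q := hy N (by simp [N])
    simpa [N, h] using hN
  · rintro rfl N _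
    exact Submodule.zero_mem _

/-- The principal submodule of an element that dies at `d`, and of which no nonzero multiple dies
earlier, is an interval module. -/
theorem isInterval_generatedBy {p : Fin (m + 1)} (x : F.obj p) {d : ℕ} (hpd : p.val < d)
    (hd : d ≤ m + 1) (hlt : ∀ q (h : p ≤ q), q.val < d → ∀ a : A, a • F.str h x = 0 → a = 0)
    (hge : ∀ q (h : p ≤ q), d ≤ q.val → F.str h x = 0) :
    (generatedBy x).toModule.IsInterval := by
  refine ⟨p.val, d, hpd, hd, ?_⟩
  -- From `p` on, a scalar is sent to that multiple of the image of `x`; `hlt` gives injectivity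
  -- before `d`, and `hge` makes the target vanish from `d` on.
  let f : ∀ q, (interval A m p.val d).obj q →ₗ[A] (generatedBy x).toModule.obj q := fun q =>
    if h : p ≤ q then
      ((LinearMap.toSpanSingleton A (F.obj q) (F.str h x)).codRestrict
        ((generatedBy x).carrier q) fun a => (mem_generatedBy_of_le x h).2 ⟨a, rfl⟩).comp
        (intervalAt A p.val d q.val).subtype
    else 0
  have hf : ∀ q (h : p ≤ q) (a : intervalAt A p.val d q.val),
      ((generatedBy x).carrier q).subtype (f q a) = a.1 • F.str h x := fun q h a => by
    have e : f q = _ := dif_pos h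
    rw [e]
    rfl
  have hsub : ∀ q : Fin (m + 1), ¬ (p.val ≤ q.val ∧ q.val < d) →
      ∀ a : intervalAt A p.val d q.val, a = 0 := fun q hq a =>
    Subtype.ext ((mem_intervalAt.1 a.2).resolve_left hq)
  have hb : ∀ q, Function.Bijective (f q) := by
    intro q
    constructor
    · refine (injective_iff_map_eq_zero (f q)).2 fun (a : intervalAt A p.val d q.val) ha => ?_
      by_cases hq : p.val ≤ q.val ∧ q.val < d
      · refine Subtype.ext (hlt q hq.1 hq.2 a.1 ?_)
        rw [← hf q hq.1, ha]
        rfl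
      · exact hsub q hq a
    · rintro ⟨y, hy⟩
      by_cases h : p ≤ q
      · obtain ⟨a, ha⟩ := (mem_generatedBy_of_le x h).1 hy
        by_cases hq : q.val < d
        · exact ⟨(⟨a, mem_intervalAt.2 (Or.inl ⟨h, hq⟩)⟩ : intervalAt A p.val d q.val),
            Subtype.ext ((hf q h _).trans ha)⟩
        · refine ⟨0, Subtype.ext ?_⟩
          rw [map_zero]
          refine Eq.trans (b := (0 : F.obj q)) rfl (Eq.trans ?_ ha)
          rw [hge q h (not_lt.1 hq), smul_zero]
      · refine ⟨0, Subtype.ext ?_⟩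
        rw [map_zero]
        exact ((mem_generatedBy_of_not_le x h).1 hy).symm
  refine (nonempty_iso f (fun q r h (a : intervalAt A p.val d q.val) => ?_) hb).map Iso.symm
  · apply Subtype.ext
    by_cases hp : p ≤ q
    · have e1 := hf r (hp.trans h) ((interval A m p.val d).str h a)
      refine e1.trans ?_
      change _ = F.str h (((generatedBy x).carrier q).subtype (f q a))
      rw [hf q hp, map_smul, str_str]
      by_cases hr : r.val < d
      · congr 1
        change (((if hpq : p.val ≤ q.val ∧ r.val < d then _ else _ :
          intervalAt A p.val d q.val →ₗ[A] intervalAt A p.val d r.val) a :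
            intervalAt A p.val d r.val) : A) = a.1
        rw [dif_pos ⟨hp, hr⟩]
        rfl
      · rw [hge r (hp.trans h) (not_lt.1 hr), smul_zero, smul_zero]
    · rw [hsub q (fun hq => hp hq.1) a]
      change ((generatedBy x).carrier r).subtype (f r ((interval A m p.val d).str h 0)) =
        ((generatedBy x).carrier r).subtype ((generatedBy x).toModule.str h (f q 0))
      rw [map_zero, map_zero, map_zero, map_zero]

/-- A persistence module that is the internal direct sum of a finite family of interval submodules
splits into intervals. -/
theorem IsDirectSum.splitsIntoIntervals {ι : Type} [DecidableEq ι] [Finite ι] {N : ι → Sub F}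
    (hN : IsDirectSum N) (hI : ∀ i, (N i).toModule.IsInterval) : F.SplitsIntoIntervals := by
  obtain ⟨n, ⟨e⟩⟩ := Finite.exists_equiv_fin ι
  refine ⟨n, fun i => (N (e.symm i)).toModule, fun i => hI _, ?_⟩
  have hint : ∀ p, DirectSum.IsInternal fun i => (N (e.symm i)).carrier p := fun p => by
    have h := DirectSum.isInternal_submodule_iff_iSupIndep_and_iSup_eq_top _ |>.1 (hN p)
    exact DirectSum.isInternal_submodule_iff_iSupIndep_and_iSup_eq_top _ |>.2
      ⟨h.1.comp e.symm.injective, (e.symm.iSup_comp (g := fun i => (N i).carrier p)).trans h.2⟩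
  refine Nonempty.map Iso.symm <| nonempty_iso (F := directSum fun i => (N (e.symm i)).toModule) (G := F)
    (fun p => DirectSum.coeLinearMap fun i => (N (e.symm i)).carrier p)
    (fun p q h x => ?_) hint
  · have key : (DirectSum.coeLinearMap fun i => (N (e.symm i)).carrier q).comp
        (DirectSum.lmap fun i => (N (e.symm i)).toModule.str h) =
        (F.str h).comp (DirectSum.coeLinearMap fun i => (N (e.symm i)).carrier p) := by
      refine DirectSum.linearMap_ext A fun i => LinearMap.ext fun y => ?_
      simp only [LinearMap.comp_apply]
      erw [DirectSum.lmap_lof, DirectSum.coeLinearMap_lof]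
      exact congrArg (F.str h)
        (DirectSum.coeLinearMap_lof (fun i => (N (e.symm i)).carrier p) i y).symm
    exact LinearMap.congr_fun key x

end Sub

/-! ### Purity of the structure maps -/

/-- The cokernels of the structure maps are torsion-free. -/
def IsPure (F : PersistenceModule A m) : Prop :=
  ∀ p q (h : p ≤ q) (c : A), c ≠ 0 → ∀ (y : F.obj q) (x : F.obj p), c • y = F.str h x →
    ∃ x', F.str h x' = y

theorem IsPure.of_iso {F G : PersistenceModule A m} (hF : F.IsPure) (e : F ≅ G) : G.IsPure := by
  intro p q h c hc y x hyx
  obtain ⟨x', hx'⟩ := hF p q h c hc ((e.inv.app q).hom y) ((e.inv.app p).hom x) (by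
    rw [← map_smul, hyx, str_naturality])
  refine ⟨(e.hom.app p).hom x', ?_⟩
  rw [← str_naturality, hx']
  exact congrArg (fun g => g.hom y) (e.inv_hom_id_app q)

/-- When both indices lie in the interval the structure map is onto. Otherwise it is zero, and `c •
y = 0` forces `y = 0` because a domain has no torsion. -/
theorem isPure_interval [IsDomain A] (b d : ℕ) : (interval A m b d).IsPure := by
  intro p q h c hc (y : intervalAt A b d q.val) x hyx
  by_cases hpq : b ≤ p.val ∧ q.val < d
  · refine ⟨(⟨y.1, mem_intervalAt.2 (Or.inl ⟨hpq.1, (Fin.le_def.1 h).trans_lt hpq.2⟩)⟩ :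
      intervalAt A b d p.val), ?_⟩
    change (if hpq : b ≤ p.val ∧ q.val < d then _ else _ :
      intervalAt A b d p.val →ₗ[A] intervalAt A b d q.val) _ = _
    rw [dif_pos hpq]
    rfl
  · refine ⟨0, ?_⟩
    rw [map_zero]
    have h0 : c • y = 0 := by
      refine Eq.trans hyx ?_
      change (if hpq : b ≤ p.val ∧ q.val < d then _ else _ :
        intervalAt A b d p.val →ₗ[A] intervalAt A b d q.val) _ = _
      rw [dif_neg hpq]
      rfl
    have h1 : c * y.1 = 0 := congrArg Subtype.val h0
    exact (Subtype.ext ((mul_eq_zero.1 h1).resolve_left hc)).symm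

/-- Preimages are chosen componentwise; since the index set is finite, they assemble to an element
of the direct sum. -/
theorem isPure_directSum {n : ℕ} {G : Fin n → PersistenceModule A m} (hG : ∀ i, (G i).IsPure) :
    (directSum G).IsPure := by
  intro p q h c hc (y : DirectSum (Fin n) fun i => (G i).obj q)
    (x : DirectSum (Fin n) fun i => (G i).obj p) hyx
  have hi : ∀ i, c • y i = (G i).str h (x i) := fun i =>
    congrArg (fun z : DirectSum (Fin n) fun i => (G i).obj q => z i) hyx
  choose x' hx' using fun i => hG i p q h c hc (y i) (x i) (hi i)
  refine ⟨(DFinsupp.equivFunOnFintype.symm x' : DirectSum (Fin n) fun i => (G i).obj p), ?_⟩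
  exact DFinsupp.ext fun i => hx' i

theorem SplitsIntoIntervals.isPure [IsDomain A] {F : PersistenceModule A m}
    (hF : F.SplitsIntoIntervals) : F.IsPure := by
  obtain ⟨n, G, hG, ⟨e⟩⟩ := hF
  refine (isPure_directSum fun i => ?_).of_iso e.symm
  obtain ⟨b, d, -, -, ⟨g⟩⟩ := hG i
  exact (isPure_interval b d).of_iso g.symm

end PersistenceModule

namespace StandardFormComplex

open StdReduction

variable {m : ℕ} (C : StandardFormComplex m)

/-! ### The boundary matrix -/

theorem exists_of_mulVec_ne_zero {M : Matrix (Fin m) (Fin m) ℤ} {a : Fin m → ℤ} {i : Fin m}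
    (h : M.mulVec a i ≠ 0) : ∃ j, M i j ≠ 0 ∧ a j ≠ 0 := by
  change ∑ j, M i j * a j ≠ 0 at h
  obtain ⟨j, -, hj⟩ := Finset.exists_ne_zero_of_sum_ne_zero h
  exact ⟨j, left_ne_zero_of_mul hj, right_ne_zero_of_mul hj⟩

theorem mulVec_apply_eq_zero {M : Matrix (Fin m) (Fin m) ℤ} {a : Fin m → ℤ} {i : Fin m}
    (h : ∀ j, M i j ≠ 0 → a j = 0) : M.mulVec a i = 0 := by
  by_contra hne
  obtain ⟨j, h1, h2⟩ := exists_of_mulVec_ne_zero hne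
  exact h2 (h j h1)

theorem mem_chains {k : ℤ} {x : Fin m → ℤ} : x ∈ C.chains k ↔ ∀ j, x j ≠ 0 → C.deg j = k := by
  rw [chains, mem_coordSpan]
  exact forall_congr' fun j => not_imp_comm

theorem mem_K {p : Fin (m + 1)} {x : Fin m → ℤ} :
    x ∈ C.K p ↔ ∀ j : Fin m, p.val ≤ j.val → x j = 0 := by
  rw [K, mem_coordSpan]
  exact forall_congr' fun j => imp_congr_left (not_lt (a := j.val))

theorem mulVec_mem_chains {k : ℤ} {x : Fin m → ℤ} (hx : x ∈ C.chains k) :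
    C.D.mulVec x ∈ C.chains (k - 1) :=
  C.D_degree k x hx

theorem mulVec_mem_K {p : Fin (m + 1)} {x : Fin m → ℤ} (hx : x ∈ C.K p) :
    C.D.mulVec x ∈ C.K p :=
  C.D_filtration p (Nat.le_of_lt_succ p.isLt) x hx

theorem single_mem_chains_iff {k : ℤ} {j : Fin m} :
    (Pi.single j 1 : Fin m → ℤ) ∈ C.chains k ↔ C.deg j = k := by
  rw [mem_chains]
  refine ⟨fun h => h j (by simp), fun h i hi => ?_⟩
  by_cases hij : i = j
  · rw [hij, h]
  · exact absurd (Pi.single_eq_of_ne hij _) hi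

theorem single_mem_K {p : Fin (m + 1)} {j : Fin m} (h : j.val < p.val) :
    (Pi.single j 1 : Fin m → ℤ) ∈ C.K p :=
  C.mem_K.2 fun i hi => Pi.single_eq_of_ne (fun e => by subst e; omega) _

theorem deg_eq_of_D_ne_zero {i j : Fin m} (h : C.D i j ≠ 0) : C.deg i = C.deg j - 1 := by
  have hm := C.mulVec_mem_chains (C.single_mem_chains_iff.2 (rfl : C.deg j = _))
  rw [Matrix.mulVec_single_one] at hm
  exact C.mem_chains.1 hm i h

/-- The filtration gives `i ≤ j`, and equality is excluded because the differential lowers the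
degree. -/
theorem lt_of_D_ne_zero {i j : Fin m} (h : C.D i j ≠ 0) : i < j := by
  have hm := C.mulVec_mem_K (C.single_mem_K (p := j.succ) (j := j) (by simp))
  rw [Matrix.mulVec_single_one] at hm
  have hle : ¬ j.val + 1 ≤ i.val := fun hle => h (C.mem_K.1 hm i hle)
  have hne : i ≠ j := fun e => by
    have := C.deg_eq_of_D_ne_zero h
    rw [e] at this
    omega
  exact lt_of_le_of_ne (Fin.le_def.2 (by omega)) hne

theorem D_mul_D : C.D * C.D = 0 := by
  refine Matrix.ext_of_mulVec_single fun j => ?_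
  rw [← Matrix.mulVec_mulVec, Matrix.zero_mulVec]
  exact C.D_sq _

theorem DQ_apply (i j : Fin m) : C.DQ i j = (C.D i j : ℚ) := rfl

theorem DQ_eq : C.DQ = C.D.map (Int.castRingHom ℚ) := rfl

theorem DQ_mul_DQ : C.DQ * C.DQ = 0 := by
  rw [DQ_eq, ← Matrix.map_mul, D_mul_D]
  ext
  simp

theorem deg_eq_of_DQ_ne_zero {i j : Fin m} (h : C.DQ i j ≠ 0) : C.deg i = C.deg j - 1 :=
  C.deg_eq_of_D_ne_zero fun h0 => h (by rw [DQ_apply, h0, Int.cast_zero])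

theorem cast_mulVec (y : Fin m → ℤ) (i : Fin m) :
    ((C.D.mulVec y i : ℤ) : ℚ) = C.DQ.mulVec (fun j => (y j : ℚ)) i :=
  RingHom.map_mulVec (Int.castRingHom ℚ) C.D y i

/-! ### The output of the standard algorithm -/

theorem R_eq_mul : C.R = C.DQ * C.V := standardAlgorithm_eq_mul _

theorem V_unitriangular : IsUnitriangular C.V := standardAlgorithm_unitriangular _

theorem R_reduced : IsReduced C.R := standardAlgorithm_reduced _

theorem R_apply_eq_zero {j r : Fin m} (h : low C.R r = j.val + 1) (i : Fin m) : C.R i j = 0 :=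
  standardAlgorithm_col_eq_zero C.DQ_mul_DQ h i

theorem deg_eq_of_V_ne_zero {i j : Fin m} (h : C.V i j ≠ 0) : C.deg i = C.deg j :=
  standardAlgorithm_degree (D := C.DQ) (fun _ _ => C.deg_eq_of_DQ_ne_zero) i j h

theorem exists_of_R_ne_zero {i j : Fin m} (h : C.R i j ≠ 0) :
    ∃ l, C.DQ i l ≠ 0 ∧ C.V l j ≠ 0 := by
  rw [R_eq_mul, Matrix.mul_apply] at h
  obtain ⟨l, -, hl⟩ := Finset.exists_ne_zero_of_sum_ne_zero h
  exact ⟨l, left_ne_zero_of_mul hl, right_ne_zero_of_mul hl⟩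

theorem deg_eq_of_R_ne_zero {i j : Fin m} (h : C.R i j ≠ 0) : C.deg i = C.deg j - 1 := by
  obtain ⟨l, h1, h2⟩ := C.exists_of_R_ne_zero h
  rw [C.deg_eq_of_DQ_ne_zero h1, C.deg_eq_of_V_ne_zero h2]

theorem lt_of_R_ne_zero {i j : Fin m} (h : C.R i j ≠ 0) : i < j := by
  obtain ⟨l, h1, h2⟩ := C.exists_of_R_ne_zero h
  have h3 : i < l := C.lt_of_D_ne_zero fun h0 => h1 (by rw [DQ_apply, h0, Int.cast_zero])
  exact h3.trans_le (not_lt.1 fun hlt => h2 (C.V_unitriangular.1 l j hlt))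

theorem R_V_integral (j : Fin m)
    (ht : ∀ k < j, 0 < low C.R k → trailing C.R k = 1 ∨ trailing C.R k = -1) :
    IsIntegralCol C.R j ∧ IsIntegralCol C.V j :=
  standardAlgorithm_integral (fun j i => ⟨C.D i j, rfl⟩) j ht

/-! ### The matrix `J` -/

theorem J_apply_of_low {j r : Fin m} (h : low C.R r = j.val + 1) (i : Fin m) :
    C.J i j = C.R i r / trailing C.R r := by
  have hex : ∃ r, low C.R r = j.val + 1 := ⟨r, h⟩
  have hr : hex.choose = r :=
    C.R_reduced _ _ (by rw [hex.choose_spec]; omega) (hex.choose_spec.trans h.symm)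
  rw [J, matchingBasis, dif_pos hex, hr]

theorem J_apply_of_not_low {j : Fin m} (h : ¬ ∃ r, low C.R r = j.val + 1) (i : Fin m) :
    C.J i j = C.V i j := by
  rw [J, matchingBasis, dif_neg h]

theorem J_unitriangular : IsUnitriangular C.J := by
  constructor
  · intro i j hij
    by_cases h : ∃ r, low C.R r = j.val + 1
    · obtain ⟨r, h⟩ := h
      rw [C.J_apply_of_low h, (low_eq_succ_iff.1 h).2 i hij, zero_div]
    · rw [C.J_apply_of_not_low h, C.V_unitriangular.1 i j hij]
  · intro j
    by_cases h : ∃ r, low C.R r = j.val + 1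
    · obtain ⟨r, h⟩ := h
      rw [C.J_apply_of_low h, ← trailing_eq h, div_self (trailing_ne_zero h)]
    · rw [C.J_apply_of_not_low h, C.V_unitriangular.2 j]

theorem deg_eq_of_J_ne_zero {i j : Fin m} (hne : C.J i j ≠ 0) : C.deg i = C.deg j := by
  by_cases h : ∃ r, low C.R r = j.val + 1
  · obtain ⟨r, h⟩ := h
    rw [C.J_apply_of_low h] at hne
    rw [C.deg_eq_of_R_ne_zero (left_ne_zero_of_mul hne),
      C.deg_eq_of_R_ne_zero (low_eq_succ_iff.1 h).1]
  · rw [C.J_apply_of_not_low h] at hne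
    exact C.deg_eq_of_V_ne_zero hne

open Classical in
/-- The matrix of the trailing entries of `R`. -/
noncomputable def trailingMatrix : Matrix (Fin m) (Fin m) ℚ :=
  fun i j => if low C.R j = i.val + 1 then C.R i j else 0

theorem trailingMatrix_ne_zero_iff {i j : Fin m} :
    C.trailingMatrix i j ≠ 0 ↔ low C.R j = i.val + 1 := by
  rw [trailingMatrix]
  split_ifs with h
  · simpa [h] using (low_eq_succ_iff.1 h).1
  · simp [h]

theorem trailingMatrix_apply {i j : Fin m} (h : low C.R j = i.val + 1) :
    C.trailingMatrix i j = trailing C.R j := by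
  rw [trailingMatrix, if_pos h, trailing_eq h]

theorem J_mul_trailingMatrix_apply {j l : Fin m} (h : low C.R j = l.val + 1) (i : Fin m) :
    (C.J * C.trailingMatrix) i j = C.R i j := by
  rw [Matrix.mul_apply, Finset.sum_eq_single_of_mem l (Finset.mem_univ _), C.J_apply_of_low h,
    C.trailingMatrix_apply h, div_mul_cancel₀ _ (trailing_ne_zero h)]
  intro l' _ hl'
  have : C.trailingMatrix l' j = 0 := by
    by_contra hne
    have := C.trailingMatrix_ne_zero_iff.1 hne
    exact hl' (Fin.ext (by omega))
  rw [this, mul_zero]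

/-- The right side is R, since each nonzero column of R is its trailing coefficient times the column
of J made from it. On the left, a column of J taken from V is sent to the column of R, and a column
taken from R is sent to 0 by D² = 0; the corresponding column of R vanishes by `R_apply_eq_zero`. -/
theorem DQ_mul_J : C.DQ * C.J = C.J * C.trailingMatrix := by
  ext i j
  have hR : ∀ i j, (C.J * C.trailingMatrix) i j = C.R i j := by
    intro i j
    rcases Nat.eq_zero_or_pos (low C.R j) with h | h
    · have h0 : ∀ l, C.trailingMatrix l j = 0 := fun l => by
        by_contra hne
        have := C.trailingMatrix_ne_zero_iff.1 hne
        omega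
      rw [Matrix.mul_apply, eq_zero_of_low_le (h.trans_le (Nat.zero_le _))]
      simp [h0]
    · obtain ⟨l, hl⟩ := exists_low_eq_succ h
      exact C.J_mul_trailingMatrix_apply hl i
  rw [hR]
  by_cases h : ∃ r, low C.R r = j.val + 1
  · obtain ⟨r, h⟩ := h
    have h0 : (C.DQ * C.R) i r = 0 := by
      rw [R_eq_mul, ← Matrix.mul_assoc, DQ_mul_DQ, Matrix.zero_mul, Matrix.zero_apply]
    rw [C.R_apply_eq_zero h, Matrix.mul_apply]
    simp only [C.J_apply_of_low h, ← mul_div_assoc]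
    rw [← Finset.sum_div, ← Matrix.mul_apply, h0, zero_div]
  · rw [R_eq_mul, Matrix.mul_apply, Matrix.mul_apply]
    simp only [C.J_apply_of_not_low h]

theorem M_eq : C.M = C.trailingMatrix := by
  have hu : IsUnit C.J.det := C.J_unitriangular.det ▸ isUnit_one
  rw [M, Matrix.mul_assoc, DQ_mul_J, ← Matrix.mul_assoc, Matrix.nonsing_inv_mul _ hu,
    Matrix.one_mul]

/-! ### Homology of a complex with a matching basis -/

/-- The columns of `J` form a basis of the graded filtered group `ℤ^m`, and `N`, the matrix of the
differential in this basis, has at most one nonzero entry, which is `1` or `-1`, in each row and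
column. -/
structure IsMatchingBasis (J N : Matrix (Fin m) (Fin m) ℤ) : Prop where
  unitriangular : IsUnitriangular J
  deg_eq : ∀ i j, J i j ≠ 0 → C.deg i = C.deg j
  D_mul : C.D * J = J * N
  entry : ∀ i j, N i j ≠ 0 → N i j * N i j = 1
  row : ∀ l r r', N l r ≠ 0 → N l r' ≠ 0 → r = r'
  col : ∀ l l' r, N l r ≠ 0 → N l' r ≠ 0 → l = l'

variable {C}

namespace IsMatchingBasis

variable {J N : Matrix (Fin m) (Fin m) ℤ} (h : C.IsMatchingBasis J N)
include h

theorem mulVec_mem_K_iff {p : Fin (m + 1)} {a : Fin m → ℤ} : J.mulVec a ∈ C.K p ↔ a ∈ C.K p := by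
  have hU : IsUnitriangular (J.map (Int.castRingHom ℚ)) :=
    ⟨fun i j hij => by simp [h.unitriangular.1 i j hij], fun j => by simp [h.unitriangular.2]⟩
  simp only [mem_K]
  constructor
  · intro hJ j hj
    have := hU.coeff_eq_zero (a := Int.castRingHom ℚ ∘ a) (n := p.val) (fun i hi => by
      rw [← RingHom.map_mulVec, hJ i hi, map_zero]) j hj
    simpa using this
  · intro ha j hj
    refine mulVec_apply_eq_zero fun i hi => ha i ?_
    by_contra hlt
    exact hi (h.unitriangular.1 j i (Fin.lt_def.2 (by omega)))

theorem mulVec_mem_chains_of_mem {k : ℤ} {a : Fin m → ℤ} (ha : a ∈ C.chains k) :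
    J.mulVec a ∈ C.chains k := by
  rw [mem_chains] at ha ⊢
  intro j hj
  obtain ⟨i, h1, h2⟩ := exists_of_mulVec_ne_zero hj
  rw [h.deg_eq j i h1, ha i h2]

theorem mulVec_mem_chains_iff {k : ℤ} {a : Fin m → ℤ} :
    J.mulVec a ∈ C.chains k ↔ a ∈ C.chains k := by
  refine ⟨fun hJ => ?_, h.mulVec_mem_chains_of_mem⟩
  -- `b` is the degree-`k` part of `a`. The vector J (a - b) has degree `k` but is built from
  -- columns of other degrees, so it is zero, and injectivity of J gives a = b.
  let b : Fin m → ℤ := fun j => if C.deg j = k then a j else 0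
  have hb : b ∈ C.chains k := C.mem_chains.2 fun j hj => by
    by_contra hne
    exact hj (if_neg hne)
  have h1 : J.mulVec (a - b) ∈ C.chains k := by
    rw [Matrix.mulVec_sub]
    exact Submodule.sub_mem _ hJ (h.mulVec_mem_chains_of_mem hb)
  have h2 : J.mulVec (a - b) = 0 := by
    funext j
    by_contra hj
    have hdeg := C.mem_chains.1 h1 j hj
    obtain ⟨i, h1, h2⟩ := exists_of_mulVec_ne_zero hj
    have e := h.deg_eq j i h1
    refine h2 ?_
    simp [b, e ▸ hdeg]
  have h3 : a - b = 0 := h.unitriangular.mulVec_injective (h2.trans (Matrix.mulVec_zero J).symm)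
  rw [sub_eq_zero.1 h3]
  exact hb

theorem N_mulVec_apply {l r : Fin m} (hlr : N l r ≠ 0) (a : Fin m → ℤ) :
    N.mulVec a l = N l r * a r := by
  refine Finset.sum_eq_single_of_mem r (Finset.mem_univ _) fun r' _ hr' => ?_
  change N l r' * a r' = 0
  by_contra hne
  exact hr' (h.row l r' r (left_ne_zero_of_mul hne) hlr)

theorem D_mulVec (a : Fin m → ℤ) : C.D.mulVec (J.mulVec a) = J.mulVec (N.mulVec a) := by
  rw [Matrix.mulVec_mulVec, h.D_mul, Matrix.mulVec_mulVec]

theorem N_col {l r : Fin m} (hlr : N l r ≠ 0) : N.mulVec (Pi.single r 1) = Pi.single l (N l r) := by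
  rw [Matrix.mulVec_single_one]
  funext i
  by_cases hi : i = l
  · rw [hi, Pi.single_eq_same]
    rfl
  · rw [Pi.single_eq_of_ne hi]
    by_contra hne
    exact hi (h.col i l r hne hlr)

theorem deg_of_N_ne_zero {l r : Fin m} (hlr : N l r ≠ 0) : C.deg l = C.deg r - 1 := by
  have h1 := C.mulVec_mem_chains
    (h.mulVec_mem_chains_iff.2 (C.single_mem_chains_iff.2 (rfl : C.deg r = _)))
  rw [h.D_mulVec, h.mulVec_mem_chains_iff, h.N_col hlr] at h1
  exact C.mem_chains.1 h1 l (by rwa [Pi.single_eq_same])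

theorem lt_of_N_ne_zero {l r : Fin m} (hlr : N l r ≠ 0) : l < r := by
  have h1 := C.mulVec_mem_K (h.mulVec_mem_K_iff.2 (C.single_mem_K (p := r.succ) (j := r) (by simp)))
  rw [h.D_mulVec, h.mulVec_mem_K_iff, h.N_col hlr] at h1
  have hle : ¬ r.val + 1 ≤ l.val := fun hle => hlr (by
    have := C.mem_K.1 h1 l hle
    rwa [Pi.single_eq_same] at this)
  have hne : l ≠ r := fun e => by
    have := h.deg_of_N_ne_zero hlr
    rw [e] at this
    omega
  exact lt_of_le_of_ne (Fin.le_def.2 (by omega)) hne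

/-- J is injective and each nonzero row of N has a single entry, so the cycle condition splits into
conditions on single coordinates. -/
theorem mulVec_mem_cycles_iff {k : ℤ} {a : Fin m → ℤ} :
    J.mulVec a ∈ C.cycles k ↔ a ∈ C.chains k ∧ ∀ l r, N l r ≠ 0 → a r = 0 := by
  have hker : J.mulVec a ∈ LinearMap.ker C.D.mulVecLin ↔ ∀ l r, N l r ≠ 0 → a r = 0 := by
    rw [LinearMap.mem_ker, Matrix.mulVecLin_apply, h.D_mulVec]
    constructor
    · intro h0 l r hlr
      have h1 : N.mulVec a = 0 :=
        h.unitriangular.mulVec_injective (h0.trans (Matrix.mulVec_zero J).symm)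
      have h2 := congrFun h1 l
      rw [h.N_mulVec_apply hlr] at h2
      exact (mul_eq_zero.1 h2).resolve_left hlr
    · intro ha
      have h1 : N.mulVec a = 0 := by
        funext l
        exact mulVec_apply_eq_zero (ha l)
      rw [h1, Matrix.mulVec_zero]
  rw [cycles, Submodule.mem_inf, h.mulVec_mem_chains_iff, hker]

theorem col_mem_cycles {k : ℤ} {j : Fin m} (hj : C.deg j = k) (hN : ∀ i, N i j = 0) :
    J.col j ∈ C.cycles k := by
  rw [← Matrix.mulVec_single_one J, h.mulVec_mem_cycles_iff]
  refine ⟨C.single_mem_chains_iff.2 hj, fun l r hlr => Pi.single_eq_of_ne ?_ _⟩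
  rintro rfl
  exact hlr (hN l)

theorem col_mem_K_iff {p : Fin (m + 1)} {j : Fin m} : J.col j ∈ C.K p ↔ j.val < p.val := by
  rw [← Matrix.mulVec_single_one J, h.mulVec_mem_K_iff]
  refine ⟨fun hm => ?_, C.single_mem_K⟩
  by_contra hlt
  exact one_ne_zero ((Pi.single_eq_same (M := fun _ => ℤ) j 1).symm.trans
    (C.mem_K.1 hm j (not_lt.1 hlt)))

/-- The shift by one arises because the unit vector with index `j` in `Fin m` first appears in the
filtration at step `j + 1`. -/
theorem birth_col (j : Fin m) : C.birth (J.col j) = j.succ := by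
  classical
  refine le_antisymm (not_lt.1 fun hlt => ?_)
    (Fin.le_def.2 (h.col_mem_K_iff.1 (C.mem_K_birth (J.col j))))
  exact Fin.find_min (p := fun p => J.col j ∈ C.K p) ⟨Fin.last m, C.mem_K_last _⟩ hlt
    (h.col_mem_K_iff.2 (by simp))

/-- Together with `col_mem_boundariesIn` this says that a combination of columns can bound in `K p`
only if each column occurring in it bounds there. This gives both independence and the absence of
torsion. -/
theorem exists_of_mem_boundariesIn {k : ℤ} {p : Fin (m + 1)} {c : Fin m → ℤ}
    (hc : J.mulVec c ∈ C.boundariesIn k p) {l : Fin m} (hl : c l ≠ 0) :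
    ∃ r : Fin m, r.val < p.val ∧ N l r ≠ 0 := by
  obtain ⟨y, ⟨-, hyp⟩, hy⟩ := hc
  obtain ⟨a, rfl⟩ := h.unitriangular.exists_mulVec_eq y
  rw [Matrix.mulVecLin_apply, h.D_mulVec] at hy
  have hca : N.mulVec a = c := h.unitriangular.mulVec_injective hy
  rw [← hca] at hl
  obtain ⟨r, hr, har⟩ := exists_of_mulVec_ne_zero hl
  refine ⟨r, ?_, hr⟩
  by_contra hlt
  exact har (C.mem_K.1 (h.mulVec_mem_K_iff.1 hyp) r (not_lt.1 hlt))

theorem col_mem_boundariesIn {p : Fin (m + 1)} {l r : Fin m}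
    (hr : r.val < p.val) (hlr : N l r ≠ 0) : J.col l ∈ C.boundariesIn (C.deg l) p := by
  -- The boundary of column `r` is `N l r` times column `l`; since `N l r` squares to 1, scaling by
  -- it again yields column `l` itself.
  refine ⟨J.mulVec (N l r • Pi.single r 1), ⟨?_, ?_⟩, ?_⟩
  · refine h.mulVec_mem_chains_iff.2 (Submodule.smul_mem _ _ (C.single_mem_chains_iff.2 ?_))
    rw [h.deg_of_N_ne_zero hlr]
    ring
  · exact h.mulVec_mem_K_iff.2 (Submodule.smul_mem _ _ (C.single_mem_K hr))
  · rw [Matrix.mulVecLin_apply, h.D_mulVec, Matrix.mulVec_smul, h.N_col hlr, ← Pi.single_smul,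
      smul_eq_mul, h.entry l r hlr, Matrix.mulVec_single_one]

end IsMatchingBasis

variable (C)

/-- The class of a cycle in the homology of `K_p`. -/
def homologyClass {k : ℤ} {p : Fin (m + 1)} (z : Fin m → ℤ) (hz : z ∈ C.cyclesIn k p) :
    (C.homology k).obj p :=
  (Submodule.Quotient.mk (⟨z, hz⟩ : C.cyclesIn k p) : C.H k p)

variable {C}

theorem homologyClass_eq_zero_iff {k : ℤ} {p : Fin (m + 1)} {z : Fin m → ℤ}
    (hz : z ∈ C.cyclesIn k p) : C.homologyClass z hz = 0 ↔ z ∈ C.boundariesIn k p :=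
  Submodule.Quotient.mk_eq_zero _

theorem exists_homologyClass_eq {k : ℤ} {p : Fin (m + 1)} (y : (C.homology k).obj p) :
    ∃ z hz, C.homologyClass (p := p) z hz = y := by
  obtain ⟨z, hz⟩ := Submodule.Quotient.mk_surjective _ (y : C.H k p)
  exact ⟨z.1, z.2, hz⟩

theorem str_homologyClass {k : ℤ} {p q : Fin (m + 1)} (h : p ≤ q) {z : Fin m → ℤ}
    (hz : z ∈ C.cyclesIn k p) : (C.homology k).str h (C.homologyClass z hz) =
      C.homologyClass z (C.cyclesIn_mono k h hz) := rfl

theorem sum_homologyClass {ι : Type*} {k : ℤ} {p : Fin (m + 1)} (t : Finset ι)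
    {z : ι → Fin m → ℤ} (hz : ∀ i, z i ∈ C.cyclesIn k p) :
    ∑ i ∈ t, C.homologyClass (z i) (hz i) =
      C.homologyClass (∑ i ∈ t, z i) (Submodule.sum_mem _ fun i _ => hz i) := by
  refine (map_sum (Submodule.mkQ ((C.boundariesIn k p).submoduleOf (C.cyclesIn k p)))
    (fun i => (⟨z i, hz i⟩ : C.cyclesIn k p)) t).symm.trans ?_
  have e : ∑ i ∈ t, (⟨z i, hz i⟩ : C.cyclesIn k p) =
      ⟨∑ i ∈ t, z i, Submodule.sum_mem _ fun i _ => hz i⟩ := Subtype.ext (by simp)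
  rw [e]
  rfl

theorem homologyClass_eq_iff {k : ℤ} {p : Fin (m + 1)} {z w : Fin m → ℤ}
    (hz : z ∈ C.cyclesIn k p) (hw : w ∈ C.cyclesIn k p) :
    C.homologyClass z hz = C.homologyClass w hw ↔ z - w ∈ C.boundariesIn k p :=
  Submodule.Quotient.eq _

theorem birth_le {p : Fin (m + 1)} {z : Fin m → ℤ} (h : z ∈ C.K p) : C.birth z ≤ p := by
  classical
  exact not_lt.1 fun hlt =>
    Fin.find_min (p := fun p => z ∈ C.K p) ⟨Fin.last m, C.mem_K_last _⟩ hlt h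

theorem homologyClass_mem_principal {k : ℤ} {p : Fin (m + 1)} {z : Fin m → ℤ}
    (hz : z ∈ C.cycles k) (hp : z ∈ C.cyclesIn k p) :
    C.homologyClass z hp ∈ (C.principal k z hz).carrier p :=
  (PersistenceModule.Sub.mem_generatedBy_of_le (F := C.homology k) _ (birth_le hp.2)).2
    ⟨1, one_smul _ _⟩

theorem exists_smul_of_mem_principal {k : ℤ} {p : Fin (m + 1)} {z : Fin m → ℤ}
    (hz : z ∈ C.cycles k) {y : (C.homology k).obj p} (hy : y ∈ (C.principal k z hz).carrier p) :
    ∃ (a : ℤ) (h : a • z ∈ C.cyclesIn k p), y = C.homologyClass (a • z) h := by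
  by_cases hp : C.birth z ≤ p
  · obtain ⟨a, rfl⟩ :=
      (PersistenceModule.Sub.mem_generatedBy_of_le (F := C.homology k) _ hp).1 hy
    exact ⟨a, Submodule.smul_mem _ a ⟨hz, C.K_mono hp (C.mem_K_birth z)⟩, rfl⟩
  · have hy0 := (PersistenceModule.Sub.mem_generatedBy_of_not_le (F := C.homology k) _ hp).1 hy
    -- Before the birth of `z` a nonzero multiple need not be a cycle of `K p`, so the coefficient 0
    -- is used.
    refine ⟨0, by simp, hy0.trans (((homologyClass_eq_zero_iff _).2 ?_).symm)⟩
    rw [zero_smul]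
    exact Submodule.zero_mem _

namespace IsMatchingBasis

variable {J N : Matrix (Fin m) (Fin m) ℤ} (h : C.IsMatchingBasis J N)
include h

theorem isInterval_principal {k : ℤ} {j : Fin m} (hz : J.col j ∈ C.cycles k) :
    (C.principal k (J.col j) hz).toModule.IsInterval := by
  have hdeg : C.deg j = k := by
    rw [← Matrix.mulVec_single_one J, h.mulVec_mem_cycles_iff, C.single_mem_chains_iff] at hz
    exact hz.1
  have hb : (C.birth (J.col j)).val = j.val + 1 := by rw [h.birth_col, Fin.val_succ]
  have hsmul : ∀ q (hq : C.birth (J.col j) ≤ q) (a : ℤ), a • J.col j ∈ C.boundariesIn k q →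
      a ≠ 0 → ∃ r : Fin m, r.val < q.val ∧ N j r ≠ 0 := by
    intro q hq a ha hne
    rw [← Matrix.mulVec_single_one J, ← Matrix.mulVec_smul] at ha
    exact h.exists_of_mem_boundariesIn ha (l := j) (by simpa using hne)
  -- The death index is `r + 1` if column `j` is matched with column `r`, and `m + 1` if it is
  -- unmatched.
  obtain ⟨d, h1, h2, h3, h4⟩ : ∃ d, j.val + 1 < d ∧ d ≤ m + 1 ∧
      (∀ r : Fin m, N j r ≠ 0 → d ≤ r.val + 1) ∧
      ∀ q : Fin (m + 1), d ≤ q.val → J.col j ∈ C.boundariesIn k q := by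
    by_cases hex : ∃ r, N j r ≠ 0
    · obtain ⟨r, hr⟩ := hex
      have := Fin.lt_def.1 (h.lt_of_N_ne_zero hr)
      exact ⟨r.val + 1, by omega, by omega, fun r' hr' => by rw [h.row j r r' hr hr'],
        fun q hq => hdeg ▸ h.col_mem_boundariesIn (by omega) hr⟩
    · exact ⟨m + 1, by omega, le_rfl, fun r hr => absurd ⟨r, hr⟩ hex, fun q hq => by omega⟩
  refine PersistenceModule.Sub.isInterval_generatedBy (F := C.homology k) _ (d := d) (by omega) h2
    (fun q hq hqd a ha => ?_) (fun q hq hqd => ?_)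
  · by_contra hne
    obtain ⟨r, hr, hjr⟩ := hsmul q hq a ((homologyClass_eq_zero_iff
      (Submodule.smul_mem _ a ⟨hz, C.K_mono hq (C.mem_K_birth _)⟩)).1 ha) hne
    have := h3 r hjr
    omega
  · exact (homologyClass_eq_zero_iff ⟨hz, C.K_mono hq (C.mem_K_birth _)⟩).2 (h4 q hqd)

theorem isDirectSum_principal {k : ℤ} {s : Set (Fin m)} [DecidableEq s]
    (hs : ∀ j, j ∈ s ↔ C.deg j = k ∧ ∀ i, N i j = 0) (hE : ∀ j : s, J.col j ∈ C.cycles k) :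
    PersistenceModule.Sub.IsDirectSum fun j : s => C.principal k (J.col j) (hE j) := by
  intro p
  rw [DirectSum.isInternal_submodule_iff_iSupIndep_and_iSup_eq_top]
  constructor
  · rw [iSupIndep_iff_finsetSum_eq_zero_imp_eq_zero]
    intro t f hf h0 j hj
    have hex : ∀ i : s, ∃ (a : ℤ) (ha : a • J.col i.1 ∈ C.cyclesIn k p),
        i ∈ t → f i = C.homologyClass (a • J.col i.1) ha := by
      intro i
      by_cases hi : i ∈ t
      · obtain ⟨a, ha, e⟩ := exists_smul_of_mem_principal (hE i) (hf i hi)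
        exact ⟨a, ha, fun _ => e⟩
      · exact ⟨0, by simp, fun hi' => absurd hi' hi⟩
    choose a ha hfa using hex
    rw [Finset.sum_congr rfl hfa, sum_homologyClass, homologyClass_eq_zero_iff] at h0
    rw [hfa j hj, homologyClass_eq_zero_iff]
    -- The coordinates, in the basis J, of the relation; a nonzero coordinate makes its own column a
    -- boundary in `K p`.
    let c : Fin m → ℤ := ∑ i ∈ t, a i • Pi.single i.1 1
    have hc : J.mulVec c = ∑ i ∈ t, a i • J.col i.1 := by
      simp only [c, Matrix.mulVec_sum, Matrix.mulVec_smul, Matrix.mulVec_single_one]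
    have hcj : c j.1 = a j := by
      simp only [c, Finset.sum_apply, Pi.smul_apply, Pi.single_apply, smul_eq_mul, mul_ite,
        mul_one, mul_zero]
      rw [Finset.sum_eq_single_of_mem j hj fun i _ hij => if_neg fun e => hij (Subtype.ext e.symm),
        if_pos rfl]
    by_cases haj : a j = 0
    · rw [haj, zero_smul]
      exact Submodule.zero_mem _
    · rw [← hc] at h0
      obtain ⟨r, hr, hjr⟩ := h.exists_of_mem_boundariesIn h0 (l := j.1) (by rwa [hcj])
      have := h.col_mem_boundariesIn hr hjr
      rw [((hs j.1).1 j.2).1] at this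
      exact Submodule.smul_mem _ _ this
  · refine eq_top_iff.2 fun y _ => ?_
    obtain ⟨z, hz, rfl⟩ := exists_homologyClass_eq y
    -- The cycles of `K p` whose class lies in the sum of the principal submodules, viewed inside
    -- ℤ^m. There, membership can be checked column by column without first knowing that each column
    -- is a cycle.
    let T : Submodule ℤ (Fin m → ℤ) :=
      ((⨆ j : s, (C.principal k (J.col j) (hE j)).carrier p).comap
        (Submodule.mkQ _ : C.cyclesIn k p →ₗ[ℤ] C.H k p)).map (C.cyclesIn k p).subtype
    have hT : ∀ j (hj : j ∈ s), j.val < p.val → J.col j ∈ T := fun j hj hjp =>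
      ⟨⟨J.col j, hE ⟨j, hj⟩, h.col_mem_K_iff.2 hjp⟩,
        Submodule.mem_iSup_of_mem (⟨j, hj⟩ : s) (homologyClass_mem_principal (hE ⟨j, hj⟩) _), rfl⟩
    have hzT : z ∈ T := by
      obtain ⟨a, rfl⟩ := h.unitriangular.exists_mulVec_eq z
      have hcyc := h.mulVec_mem_cycles_iff.1 hz.1
      have hK := h.mulVec_mem_K_iff.1 hz.2
      have hsum : J.mulVec a = ∑ j, a j • J.col j := by
        simp only [Matrix.mulVec_eq_sum, op_smul_eq_smul]
        rfl
      rw [hsum]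
      refine Submodule.sum_mem _ fun j _ => ?_
      by_cases ha : a j = 0
      · simp [ha]
      · refine Submodule.smul_mem _ _ (hT j ((hs j).2 ⟨C.mem_chains.1 hcyc.1 j ha, fun i => ?_⟩) ?_)
        · by_contra hij
          exact ha (hcyc.2 i j hij)
        · by_contra hlt
          exact ha (C.mem_K.1 hK j (not_lt.1 hlt))
    obtain ⟨w, hw, rfl⟩ := hzT
    exact hw

end IsMatchingBasis

end StandardFormComplex

/-! ### Unit trailing coefficients: the integral matching basis, and the converse through purity. -/

namespace StandardFormComplex

open StdReduction

variable {m : ℕ} (C : StandardFormComplex m)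

/-- Dividing by ±1 keeps J integral, and the rational identities descend along the injection of ℤ
into ℚ. At most one entry per row is reducedness of R; at most one per column holds because a column
has only one last row. -/
theorem exists_isMatchingBasis
    (ht : ∀ j, 0 < low C.R j → trailing C.R j = 1 ∨ trailing C.R j = -1) :
    ∃ J N : Matrix (Fin m) (Fin m) ℤ, (J.map fun a => (a : ℚ)) = C.J ∧
      (N.map fun a => (a : ℚ)) = C.trailingMatrix ∧ C.IsMatchingBasis J N := by
  have hRV := fun j => C.R_V_integral j fun k _ => ht k
  have hJ : ∀ i j, ∃ a : ℤ, (a : ℚ) = C.J i j := fun i j => by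
    by_cases h : ∃ r, low C.R r = j.val + 1
    · obtain ⟨r, h⟩ := h
      obtain ⟨a, ha⟩ := (hRV r).1 i
      rw [C.J_apply_of_low h, ← ha]
      rcases ht r (by omega) with e | e <;> rw [e]
      · exact ⟨a, by simp⟩
      · exact ⟨-a, by simp [div_neg]⟩
    · rw [C.J_apply_of_not_low h]
      exact (hRV j).2 i
  have hN : ∀ i j, ∃ a : ℤ, (a : ℚ) = C.trailingMatrix i j := fun i j => by
    rw [trailingMatrix]
    split_ifs
    · exact (hRV j).1 i
    · exact ⟨0, Int.cast_zero⟩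
  obtain ⟨J, hJ⟩ : ∃ J : Matrix (Fin m) (Fin m) ℤ, ∀ i j, (J i j : ℚ) = C.J i j := by
    choose J hJ using hJ
    exact ⟨J, hJ⟩
  obtain ⟨N, hN⟩ : ∃ N : Matrix (Fin m) (Fin m) ℤ, ∀ i j, (N i j : ℚ) = C.trailingMatrix i j := by
    choose N hN using hN
    exact ⟨N, hN⟩
  have hJm : J.map (Int.castRingHom ℚ) = C.J := Matrix.ext hJ
  have hNm : N.map (Int.castRingHom ℚ) = C.trailingMatrix := Matrix.ext hN
  have hJ0 : ∀ i j, J i j ≠ 0 → C.J i j ≠ 0 := fun i j h => by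
    rwa [← hJ, Int.cast_ne_zero]
  have hN0 : ∀ {i j}, N i j ≠ 0 → low C.R j = i.val + 1 := fun {i j} h => by
    rwa [← C.trailingMatrix_ne_zero_iff, ← hN, Int.cast_ne_zero]
  refine ⟨J, N, hJm, hNm, ⟨fun i j hij => ?_, fun j => ?_⟩, fun i j h => ?_, ?_, fun i j h => ?_,
    fun l r r' h h' => ?_, fun l l' r h h' => ?_⟩
  · exact Int.cast_eq_zero.1 ((hJ i j).trans (C.J_unitriangular.1 i j hij))
  · exact Int.cast_eq_one.1 ((hJ j j).trans (C.J_unitriangular.2 j))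
  · exact C.deg_eq_of_J_ne_zero (hJ0 i j h)
  · refine Matrix.map_injective (f := Int.castRingHom ℚ) Int.cast_injective ?_
    change (C.D * J).map (Int.castRingHom ℚ) = (J * N).map (Int.castRingHom ℚ)
    rw [Matrix.map_mul, Matrix.map_mul, hJm, hNm, ← DQ_eq, DQ_mul_J]
  · have hlow := hN0 h
    have : ((N i j * N i j : ℤ) : ℚ) = 1 := by
      push_cast
      rw [hN, C.trailingMatrix_apply hlow]
      rcases ht j (by omega) with e | e <;> rw [e] <;> norm_num
    exact_mod_cast this
  · exact C.R_reduced r r' (by rw [hN0 h]; omega) ((hN0 h).trans (hN0 h').symm)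
  · have e1 := hN0 h
    have e2 := hN0 h'
    exact Fin.ext (by omega)

/-- Trailing coefficients are units if the cokernels of the structure maps are torsion-free. If row
`i` holds the trailing coefficient `c` of column `r`, and all earlier trailing coefficients are
units, then `c` times column `i` of `V` is homologous in `K_{r + 1}` to a cycle of `K_i`. -/
theorem trailing_of_isPure (hpure : ∀ k, (C.homology k).IsPure) (r : Fin m)
    (hr : 0 < low C.R r) : trailing C.R r = 1 ∨ trailing C.R r = -1 := by
  induction r using WellFoundedLT.induction with
  | ind r ih =>
  obtain ⟨i, hi⟩ := exists_low_eq_succ hr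
  obtain ⟨hne, hz⟩ := low_eq_succ_iff.1 hi
  have hir := C.lt_of_R_ne_zero hne
  have hDV : ∀ j, C.DQ.mulVec (C.V.col j) = C.R.col j := fun j => by
    rw [R_eq_mul]
    rfl
  -- Integral lifts: `z` of column `r` of R, `v` of column `r` of V, and `x` of column `i` of V. The
  -- induction hypothesis suffices for all three because `i < r`.
  choose z hzR using (C.R_V_integral r ih).1
  choose v hv using (C.R_V_integral r ih).2
  choose x hx using (C.R_V_integral i fun k hk => ih k (hk.trans hir)).2
  have hDv : C.D.mulVec v = z := by
    funext l
    refine Int.cast_injective (α := ℚ) ?_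
    rw [cast_mulVec, hzR, funext hv]
    exact congrFun (hDV r) l
  have hDx : C.D.mulVec x = 0 := by
    funext l
    refine Int.cast_injective (α := ℚ) ?_
    rw [cast_mulVec, funext hx, Pi.zero_apply, Int.cast_zero, ← C.R_apply_eq_zero hi l]
    exact congrFun (hDV i) l
  have hxi : x i = 1 := Int.cast_eq_one.1 ((hx i).trans (C.V_unitriangular.2 i))
  have hxz : ∀ l, i < l → x l = 0 := fun l hl =>
    Int.cast_eq_zero.1 ((hx l).trans (C.V_unitriangular.1 l i hl))
  have hzz : ∀ l, i < l → z l = 0 := fun l hl => Int.cast_eq_zero.1 ((hzR l).trans (hz l hl))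
  have hzi : z i ≠ 0 := by
    rwa [← Int.cast_ne_zero (α := ℚ), hzR]
  have hxcyc : x ∈ C.cycles (C.deg i) :=
    ⟨C.mem_chains.2 fun j hj => C.deg_eq_of_V_ne_zero (by rwa [← hx, Int.cast_ne_zero]), hDx⟩
  have hvch : v ∈ C.chains (C.deg i + 1) := C.mem_chains.2 fun j hj => by
    rw [C.deg_eq_of_V_ne_zero (i := j) (j := r) (by rwa [← hv, Int.cast_ne_zero]),
      C.deg_eq_of_R_ne_zero hne, sub_add_cancel]
  have hvK : v ∈ C.K r.succ := C.mem_K.2 fun j hj =>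
    Int.cast_eq_zero.1 ((hv j).trans (C.V_unitriangular.1 j r (by
      rw [Fin.val_succ] at hj; exact Fin.lt_def.2 (by omega))))
  have hzB : z ∈ C.boundariesIn (C.deg i) r.succ := ⟨v, ⟨hvch, hvK⟩, hDv⟩
  have hxK : x ∈ C.K r.succ := C.mem_K.2 fun j hj =>
    hxz j (Fin.lt_def.2 (by rw [Fin.val_succ] at hj; have := Fin.lt_def.1 hir; omega))
  have hle : i.castSucc ≤ r.succ := Fin.le_def.2 (by
    simp only [Fin.val_castSucc, Fin.val_succ]; have := Fin.lt_def.1 hir; omega)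
  -- Both terms end in row `i` with the same entry `z i`, so their difference is supported strictly
  -- before `i`.
  have hwcyc : z i • x - z ∈ C.cyclesIn (C.deg i) i.castSucc := by
    refine ⟨Submodule.sub_mem _ (Submodule.smul_mem _ _ hxcyc)
      (C.boundariesIn_le_cyclesIn _ _ hzB).1, C.mem_K.2 fun j hj => ?_⟩
    rcases (Fin.le_def.2 hj : i ≤ j).eq_or_lt with rfl | hlt
    · simp [hxi]
    · simp [hxz j hlt, hzz j hlt]
  have hxC : x ∈ C.cyclesIn (C.deg i) r.succ := ⟨hxcyc, hxK⟩
  -- In homology `z i` times the class of `x` equals the image of the class of `z i • x - z`,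
  -- because `z` is a boundary; purity removes the factor `z i`.
  obtain ⟨y', hy'⟩ := hpure (C.deg i) i.castSucc r.succ hle (z i) hzi
    (C.homologyClass x hxC) (C.homologyClass _ hwcyc) (by
      refine (homologyClass_eq_iff (Submodule.smul_mem _ (z i) hxC)
        (C.cyclesIn_mono _ hle hwcyc)).2 ?_
      rw [sub_sub_cancel]
      exact hzB)
  obtain ⟨w, hw, rfl⟩ := exists_homologyClass_eq y'
  rw [str_homologyClass] at hy'
  obtain ⟨y, ⟨-, hyK⟩, hy⟩ := (homologyClass_eq_iff _ _).1 hy'.symm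
  rw [Matrix.mulVecLin_apply] at hy
  obtain ⟨a, ha⟩ := C.V_unitriangular.exists_mulVec_eq fun j => (y j : ℚ)
  have hwz : ∀ l, i ≤ l → w l = 0 := fun l hl => C.mem_K.1 hw.2 l (Fin.le_def.1 hl)
  have hRa : ∀ l, C.R.mulVec a l = ((x l - w l : ℤ) : ℚ) := fun l => by
    rw [R_eq_mul, ← Matrix.mulVec_mulVec, ha, ← cast_mulVec, hy, Pi.sub_apply]
  -- The coefficients `a` are a priori rational. The one at `r` is an integer because `y` vanishes
  -- past `r` and V is unitriangular.
  have har : a r = y r := by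
    rw [← C.V_unitriangular.mulVec_apply_last (a := a) (l := r), ha]
    intro l hl
    simp [ha, C.mem_K.1 hyK l (by rw [Fin.val_succ]; exact Fin.lt_def.1 hl)]
  -- R a = x - w vanishes below row `i`, so no column ending lower contributes; row `i` then reads 1
  -- = (trailing coefficient) · `y r`.
  have hlead := C.R_reduced.mulVec_apply_of_low_eq (a := a) hi fun j' hj' =>
    C.R_reduced.coeff_eq_zero (n := i.val + 1) (fun l hl => by
      have hil : i < l := Fin.lt_def.2 (by omega)
      rw [hRa, hxz l hil, hwz l hil.le, sub_zero, Int.cast_zero]) j' hj'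
  rw [hRa, hxi, hwz i le_rfl, har, ← hzR] at hlead
  have hunit : z i * y r = 1 := by exact_mod_cast hlead.symm
  rw [trailing_eq hi, ← hzR]
  rcases Int.eq_one_or_neg_one_of_mul_eq_one hunit with e | e <;> rw [e]
  · exact Or.inl Int.cast_one
  · exact Or.inr (by simp)

end StandardFormComplex

theorem mainTheorem5 (m : ℕ) (C : StandardFormComplex m) :
    List.TFAE
      [ -- every trailing coefficient of a nonzero column of `R` is a unit
        ∀ j, (∃ i, C.R i j ≠ 0) → StdReduction.trailing C.R j = 1 ∨ StdReduction.trailing C.R j = -1,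
        -- every homology module splits as a direct sum of interval modules
        ∀ k : ℤ, (C.homology k).SplitsIntoIntervals,
        -- explicit splitting by principal submodules generated by columns of `J`, which is integral
        ∃ J' : Matrix (Fin m) (Fin m) ℤ, (J'.map fun a => (a : ℚ)) = C.J ∧
          ∀ k : ℤ, ∃ hE : ∀ j : C.E k, J'.col j ∈ C.cycles k,
            PersistenceModule.Sub.IsDirectSum
                (fun j : C.E k => C.principal k (J'.col j) (hE j)) ∧
              ∀ j : C.E k, (C.principal k (J'.col j) (hE j)).toModule.IsInterval ] := by
  tfae_have 1 → 3 := by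
    intro ht
    obtain ⟨J, N, hJ, hN, h⟩ := C.exists_isMatchingBasis fun j hj =>
      ht j (StdReduction.low_pos_iff.1 hj)
    have hmem : ∀ k j, j ∈ C.E k ↔ C.deg j = k ∧ ∀ i, N i j = 0 := fun k j => by
      change Pi.single j 1 ∈ C.chains k ∧ (∀ i, C.M i j = 0) ↔ _
      rw [C.single_mem_chains_iff, C.M_eq, ← hN]
      simp only [Matrix.map_apply, Int.cast_eq_zero]
    have hE : ∀ k, ∀ j : C.E k, J.col j ∈ C.cycles k := fun k j =>
      h.col_mem_cycles ((hmem k j).1 j.2).1 ((hmem k j).1 j.2).2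
    exact ⟨J, hJ, fun k => ⟨hE k, h.isDirectSum_principal (hmem k) (hE k),
      fun j => h.isInterval_principal (hE k j)⟩⟩
  tfae_have 3 → 2 := by
    rintro ⟨J, -, h⟩ k
    obtain ⟨hE, hsum, hint⟩ := h k
    exact hsum.splitsIntoIntervals hint
  tfae_have 2 → 1 := fun h j hj =>
    C.trailing_of_isPure (fun k => (h k).isPure) j (StdReduction.low_pos_iff.2 hj)
  tfae_finish
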